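/- Let $\mathbb F_q$ be any finite field and $\overline{\mathbb F}_q$ its algebraic closure. For a field $K$, two nonconstant $f,g\in K(X)$ are called equivalent over $K$ if $g=\psi\circ f\circ\phi$ for some degree one rational functions $\psi,\phi\in K(X)$. The degree of a rational function is the maximum of the degrees of its coprime numerator and denominator. A rational function $f\in\mathbb F_q(X)$ of degree $3$, regarded as a map of $\mathbb P^1(\mathbb F_q)$ to itself, is in Class III if $|f^{-1}(\alpha)|=3$ for some $\alpha\in\mathbb P^1(\mathbb F_q)$ and $|f^{-1}(\beta)|\ne 2$ for all $\beta\in\mathbb P^1(\mathbb F_q)$. It is in Class III-b if moreover it is equivalent over $\mathbb F_q$ to some $$f_{s,t}=\frac{X^3+sX+t}{X(X-1)},\qquad s,t\in\mathbb F_q,\ t(1+s+t)\neq 0,$$ for which $G_{s,t}=X^4-2X^3-sX^2-2tX+t$ is a product of two different monic irreducible quadratics over $\mathbb F_q$. The ramification points of such an $f$ in $\mathbb P^1(\overline{\mathbb F}_q)$ are then four distinct points $\rho_1,\rho_1^q,\rho_2,\rho_2^q$ of degree $2$ over $\mathbb F_q$, each of ramification index $2$. For $f$ in Class III-b, define $\theta(f)=0$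 if $f$ is equivalent over $\overline{\mathbb F}_q$ to $(X^3+1)/X$, and $\theta(f)=1/t$ if $f$ is equivalent over $\overline{\mathbb F}_q$ to $(X^3+X^2+t)/X$ with $t\in\overline{\mathbb F}_q\setminus\{0\}$ (exactly one of these cases occurs, for a unique $t$ in the second case). Define $\lambda(f)=C+C^{-1}$, where $$C=\frac{(\rho_1-\rho_2)(\rho_1^q-\rho_2^q)}{(\rho_1-\rho_2^q)(\rho_1^q-\rho_2)}$$ is the cross ratio of $\rho_1,\rho_1^q,\rho_2,\rho_2^q$; $\lambda(f)$ does not depend on the labelling of the ramification points. **Theorem.** If $f,g\in\mathbb F_q(X)$ are in Class III-b, $\theta(f)=\theta(g)$ and $\lambda(f)=\lambda(g)\notin\{1,5/2\}$, then $f$ and $g$ are equivalent over $\mathbb F_q$. -/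

import Mathlib

noncomputable section

namespace CubicRat

/-- The degree of a rational function: the larger of the degrees of its reduced numerator and
denominator. -/
def ratDegree {K : Type*} [Field K] (f : RatFunc K) : ℕ :=
  max f.num.natDegree f.denom.natDegree

/-- For `A = !![a, b; c, d]`, the rational function `(a h + b) / (c h + d)`. Thus
`moebius A RatFunc.X` is the degree one rational function attached to `A`, and `moebius A h` is its
composition with `h`. -/
def moebius {K : Type*} [Field K] (A : GL (Fin 2) K) (h : RatFunc K) : RatFunc K :=
  (RatFunc.C (A 0 0) * h + RatFunc.C (A 0 1)) / (RatFunc.C (A 1 0) * h + RatFunc.C (A 1 1))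

/-- The composition `f ∘ h`, obtained by substituting the nonconstant function `h` for `X`. -/
def comp {K : Type*} [Field K] (f h : RatFunc K) : RatFunc K :=
  RatFunc.eval RatFunc.C h f

/-- Equivalence over `K`: `g = ψ ∘ f ∘ φ` for some `ψ, φ` in `PGL(2, K)`. -/
def Equivalent {K : Type*} [Field K] (f g : RatFunc K) : Prop :=
  ∃ ψ φ : GL (Fin 2) K, g = moebius ψ (comp f (moebius φ RatFunc.X))

/-- A rational function over `F` viewed as a rational function over an extension `K`. -/
def baseChange {F : Type*} [Field F] (K : Type*) [Field K] [Algebra F K] :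
    RatFunc F →+* RatFunc K :=
  RatFunc.mapRingHom (Polynomial.mapRingHom (algebraMap F K))
    (nonZeroDivisors_le_comap_nonZeroDivisors_of_injective _
      (Polynomial.map_injective _ (algebraMap F K).injective))

/-! ### Values on the projective line -/

/-- The value in `K ∪ {∞}` of `f` at a finite point. -/
def valAt {K : Type*} [Field K] (f : RatFunc K) (a : K) : OnePoint K :=
  open Classical in
  if f.denom.eval a = 0 then OnePoint.infty
  else ((f.num.eval a / f.denom.eval a : K) : OnePoint K)

/-- The self-map of `K ∪ {∞}` induced by `f`; the value at `∞` is that of `f(1/X)` at `0`. -/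
def toFun {K : Type*} [Field K] (f : RatFunc K) : OnePoint K → OnePoint K
  | none => valAt (comp f RatFunc.X⁻¹) 0
  | some a => valAt f a

/-- The ramification index of `f` at a finite point `a`: the order of vanishing at `a` of
`f - f(a)` if `f(a)` is finite, and of `1/f` if `f(a) = ∞`. -/
def ramIdxAt {K : Type*} [Field K] (f : RatFunc K) (a : K) : ℕ :=
  match valAt f a with
  | none => (f⁻¹).num.rootMultiplicity a
  | some b => (f - RatFunc.C b).num.rootMultiplicity a

/-- The ramification index of `f` at a point of `K ∪ {∞}`; at `∞` it is that of `f(1/X)` at `0`. -/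
def ramIdx {K : Type*} [Field K] (f : RatFunc K) : OnePoint K → ℕ
  | none => ramIdxAt (comp f RatFunc.X⁻¹) 0
  | some a => ramIdxAt f a

/-- The set of ramification points, in `K ∪ {∞}`, of a rational function over `K`. -/
def ramSet {K : Type*} [Field K] (f : RatFunc K) : Set (OnePoint K) :=
  {a | 1 < ramIdx f a}

/-! ### Class III and its subclass III-b -/

/-- Class III: `deg f = 3`, some point of the projective line over `F` has three preimages there,
and no such point has exactly two. -/
def ClassIII {F : Type*} [Field F] (f : RatFunc F) : Prop :=
  ratDegree f = 3 ∧ (∃ α : OnePoint F, (toFun f ⁻¹' {α}).ncard = 3) ∧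
    ∀ β : OnePoint F, (toFun f ⁻¹' {β}).ncard ≠ 2

/-- `f_{s,t} = (X³ + sX + t) / (X(X - 1))`. -/
def fst {F : Type*} [Field F] (s t : F) : RatFunc F :=
  (RatFunc.X ^ 3 + RatFunc.C s * RatFunc.X + RatFunc.C t) / (RatFunc.X * (RatFunc.X - 1))

open Polynomial in
/-- `G_{s,t} = X⁴ - 2X³ - sX² - 2tX + t`, the numerator of the derivative of `f_{s,t}`. -/
def gst {F : Type*} [Field F] (s t : F) : F[X] :=
  X ^ 4 - 2 * X ^ 3 - C s * X ^ 2 - 2 * C t * X + C t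

open Polynomial in
/-- Class III-b: `f` lies in Class III and is equivalent to some `f_{s,t}`, with
`t (1 + s + t) ≠ 0`, for which `G_{s,t}` is a product of two different (monic) irreducible
quadratics over `F`. -/
def ClassIIIb {F : Type*} [Field F] (f : RatFunc F) : Prop :=
  ClassIII f ∧ ∃ s t : F, t ≠ 0 ∧ 1 + s + t ≠ 0 ∧ Equivalent f (fst s t) ∧
    ∃ P Q : F[X], P.Monic ∧ Q.Monic ∧ P.natDegree = 2 ∧ Q.natDegree = 2 ∧
      Irreducible P ∧ Irreducible Q ∧ P ≠ Q ∧ gst s t = P * Q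

/-! ### The invariant `θ` -/

/-- `c` is the value of `θ` at the rational function `f` over `K`: either `c = 0` and
`f ∼ (X³ + 1)/X`, or `c = 1/t` and `f ∼ (X³ + X² + t)/X` with `t ≠ 0`. -/
def IsTheta {K : Type*} [Field K] (f : RatFunc K) (c : K) : Prop :=
  (c = 0 ∧ Equivalent f ((RatFunc.X ^ 3 + 1) / RatFunc.X)) ∨
    ∃ t : K, t ≠ 0 ∧ c = 1 / t ∧
      Equivalent f ((RatFunc.X ^ 3 + RatFunc.X ^ 2 + RatFunc.C t) / RatFunc.X)

/-- `θ(f)`, where `f` is regarded as a rational function over the algebraic closure. A cubic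
function with a ramification point of index `2` has exactly one such value. -/
def theta {F : Type*} [Field F] (f : RatFunc F) : AlgebraicClosure F :=
  Classical.epsilon (IsTheta (baseChange (AlgebraicClosure F) f))

/-! ### The invariant `λ` -/

/-- The cross ratio `(x₁, x₂; x₃, x₄)`. -/
def crossRatio {K : Type*} [Field K] (x₁ x₂ x₃ x₄ : K) : K :=
  ((x₁ - x₃) * (x₂ - x₄)) / ((x₁ - x₄) * (x₂ - x₃))

/-- `c` is the value of `λ` at the rational function `f` over the field `F` with `q` elements:
the ramification points of `f` over the algebraic closure are four distinct points
`ρ₁, ρ₁^q, ρ₂, ρ₂^q`, all of degree two over `F`, and `c = C + C⁻¹` with `C` their cross ratio in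
this order. -/
def IsLambda {F : Type*} [Field F] (f : RatFunc F) (c : AlgebraicClosure F) : Prop :=
  ∃ ρ₁ ρ₂ : AlgebraicClosure F,
    (ρ₁ ^ Nat.card F) ^ Nat.card F = ρ₁ ∧ (ρ₂ ^ Nat.card F) ^ Nat.card F = ρ₂ ∧
    ρ₁ ^ Nat.card F ≠ ρ₁ ∧ ρ₂ ^ Nat.card F ≠ ρ₂ ∧ ρ₂ ≠ ρ₁ ∧ ρ₂ ≠ ρ₁ ^ Nat.card F ∧
    ramSet (baseChange (AlgebraicClosure F) f) =
      (fun x : AlgebraicClosure F => (x : OnePoint (AlgebraicClosure F))) ''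
        {ρ₁, ρ₁ ^ Nat.card F, ρ₂, ρ₂ ^ Nat.card F} ∧
    c = crossRatio ρ₁ (ρ₁ ^ Nat.card F) ρ₂ (ρ₂ ^ Nat.card F) +
      (crossRatio ρ₁ (ρ₁ ^ Nat.card F) ρ₂ (ρ₂ ^ Nat.card F))⁻¹

theorem crossRatio_swap {K : Type*} [Field K] (x₁ x₂ x₃ x₄ : K) :
    crossRatio x₂ x₁ x₃ x₄ = (crossRatio x₁ x₂ x₃ x₄)⁻¹ := by
  rw [crossRatio, crossRatio, inv_div]; congr 1 <;> ring

theorem crossRatio_swap' {K : Type*} [Field K] (x₁ x₂ x₃ x₄ : K) :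
    crossRatio x₁ x₂ x₄ x₃ = (crossRatio x₁ x₂ x₃ x₄)⁻¹ := by
  rw [crossRatio, crossRatio, inv_div]

theorem crossRatio_comm {K : Type*} [Field K] (x₁ x₂ x₃ x₄ : K) :
    crossRatio x₃ x₄ x₁ x₂ = crossRatio x₁ x₂ x₃ x₄ := by
  rw [crossRatio, crossRatio]; congr 1 <;> ring

/-- Relabelling the two pairs of conjugate ramification points does not change `λ`. -/
theorem IsLambda.unique {F : Type*} [Field F] {f : RatFunc F} {c c' : AlgebraicClosure F}
    (h : IsLambda f c) (h' : IsLambda f c') : c = c' := by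
  obtain ⟨r, s, hr, hs, hr1, hs1, hsr, hsr', hset, rfl⟩ := h
  obtain ⟨u, v, hu, hv, hu1, hv1, hvu, hvu', hset', rfl⟩ := h'
  have hE : ({u, u ^ Nat.card F, v, v ^ Nat.card F} : Set (AlgebraicClosure F)) =
      {r, r ^ Nat.card F, s, s ^ Nat.card F} :=
    Set.image_injective.mpr OnePoint.coe_injective (hset'.symm.trans hset)
  have hum : u ∈ ({r, r ^ Nat.card F, s, s ^ Nat.card F} : Set (AlgebraicClosure F)) := by
    rw [← hE]; simp
  have hvm : v ∈ ({r, r ^ Nat.card F, s, s ^ Nat.card F} : Set (AlgebraicClosure F)) := by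
    rw [← hE]; simp
  simp only [Set.mem_insert_iff, Set.mem_singleton_iff] at hum hvm
  generalize hN : Nat.card F = n at *
  have key : crossRatio u (u ^ n) v (v ^ n) = crossRatio r (r ^ n) s (s ^ n) ∨
      crossRatio u (u ^ n) v (v ^ n) = (crossRatio r (r ^ n) s (s ^ n))⁻¹ := by
    rcases hum with h1 | h1 | h1 | h1 <;> rcases hvm with h2 | h2 | h2 | h2 <;>
      simp only [h1, h2, hr, hs, ne_eq, not_true_eq_false] at hvu hvu' ⊢
    · exact .inl trivial
    · exact .inr (crossRatio_swap' ..)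
    · exact .inr (crossRatio_swap ..)
    · left; rw [crossRatio_swap, crossRatio_swap', inv_inv]
    · exact .inl (crossRatio_comm ..)
    · right; rw [crossRatio_swap', crossRatio_comm]
    · right; rw [crossRatio_swap, crossRatio_comm]
    · left; rw [crossRatio_swap, crossRatio_swap', inv_inv, crossRatio_comm]
  rcases key with h | h
  · rw [h]
  · rw [h, inv_inv, add_comm]

/-- `λ(f)`, for `f` in Class III-b. -/
def lambda {F : Type*} [Field F] (f : RatFunc F) : AlgebraicClosure F :=
  Classical.epsilon (IsLambda f)

end CubicRat

end

noncomputable section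

namespace CubicRat

/-! Equality of `θ` makes `f` and `g` equivalent over the algebraic closure, because both are
equivalent there to the same normal form; write `g = ψ ∘ f ∘ φ`. The task is to descend `φ` and `ψ`
to `F`. Since `θ` and `λ` are chosen by `Classical.epsilon`, a value must first be shown to exist:
`ClassIIIb.exists_isTheta` does this for `θ` and `ClassIIIb.exists_ramPts` for the points defining
`λ`. Uniqueness is needed only for `λ`.

The map `φ` carries the four ramification points of `g` to those of `f` and preserves cross ratios.
If it broke up a conjugate pair, the cross ratio `C` attached to `f` would be replaced by `1 - C` or
its inverse, so equality of the `λ` would give `C + 1/C = (1 - C) + 1/(1 - C)`, that is `(2C - 1)(C²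
- C + 1) = 0`. Then `λ` is `5/2` or `1`, and these are excluded. Hence conjugate pairs go to
conjugate pairs (`RamPts.conjugate_of_crossRatio`).

So `φ` commutes with Frobenius at the ramification points. A degree one function is determined by
three values, so `φ` agrees with its Frobenius conjugate up to a scalar and, suitably scaled, has
entries in `F` (`exists_glMap_proportional`). Now `f ∘ φ` and `g` are both defined over `F`, and `ψ`
is a solution of homogeneous linear equations over `F`; a suitable linear functional turns it into a
solution over `F` (`exists_moebius_of_baseChange`). -/

/-- A rational function is nonconstant. -/
def Nonconst {K : Type*} [Field K] (h : RatFunc K) : Prop := ¬ ∃ c, h = RatFunc.C c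

/-! ### Degree one functions, substitution, and equivalence -/

section Moebius

variable {K : Type*} [Field K]

theorem gl_det_ne_zero (A : GL (Fin 2) K) : A 0 0 * A 1 1 - A 0 1 * A 1 0 ≠ 0 := by
  have := A.det.ne_zero
  rwa [Matrix.GeneralLinearGroup.val_det_apply, Matrix.det_fin_two] at this

/-- The invertible matrix with the given entries. -/
def mkGL (a b c d : K) (h : a * d - b * c ≠ 0) : GL (Fin 2) K :=
  Matrix.GeneralLinearGroup.mkOfDetNeZero !![a, b; c, d] (by rwa [Matrix.det_fin_two_of])

theorem moebius_mkGL (a b c d : K) (h : a * d - b * c ≠ 0) (f : RatFunc K) :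
    moebius (mkGL a b c d h) f =
      (RatFunc.C a * f + RatFunc.C b) / (RatFunc.C c * f + RatFunc.C d) := by
  simp [moebius, mkGL, Matrix.GeneralLinearGroup.mkOfDetNeZero]

theorem Nonconst.linear_ne_zero {h : RatFunc K} (hh : Nonconst h) {c d : K}
    (hcd : c ≠ 0 ∨ d ≠ 0) : RatFunc.C c * h + RatFunc.C d ≠ 0 := by
  intro h0
  by_cases hc : c = 0
  · subst hc
    simp at h0
    simp [h0] at hcd
  · refine hh ⟨-d / c, ?_⟩
    have hc' : RatFunc.C c ≠ 0 := by simpa using hc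
    rw [map_div₀, eq_div_iff hc', map_neg]
    linear_combination h0

/-- Division by zero has a default value in `RatFunc`, so the group laws for `moebius` hold only
when the denominator is a genuine one; nonconstancy of `h` guarantees this. -/
theorem Nonconst.gl_denom_ne_zero {h : RatFunc K} (hh : Nonconst h) (A : GL (Fin 2) K) :
    RatFunc.C (A 1 0) * h + RatFunc.C (A 1 1) ≠ 0 := by
  refine hh.linear_ne_zero ?_
  by_contra! h0
  exact gl_det_ne_zero A (by rw [h0.1, h0.2]; ring)

theorem nonconst_of_linear_indep {h u v : RatFunc K} (hu : h = u / v) (hv : v ≠ 0)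
    (H : ∀ c, u ≠ RatFunc.C c * v) : Nonconst h := by
  rintro ⟨c, hc⟩
  refine H c ?_
  rw [← hc, hu, div_mul_cancel₀ _ hv]

theorem Nonconst.moebius {h : RatFunc K} (hh : Nonconst h) (A : GL (Fin 2) K) :
    Nonconst (moebius A h) := by
  refine nonconst_of_linear_indep rfl (hh.gl_denom_ne_zero A) fun c hc => ?_
  have : RatFunc.C (A 0 0 - c * A 1 0) * h + RatFunc.C (A 0 1 - c * A 1 1) = 0 := by
    simp only [map_sub, map_mul]
    linear_combination hc
  refine hh.linear_ne_zero ?_ this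
  by_contra! h0
  refine gl_det_ne_zero A ?_
  linear_combination A 1 1 * h0.1 - A 1 0 * h0.2

theorem moebius_mul {h : RatFunc K} (hh : Nonconst h) (A B : GL (Fin 2) K) :
    moebius (A * B) h = moebius A (moebius B h) := by
  have h1 := hh.gl_denom_ne_zero B
  have h2 := (hh.moebius B).gl_denom_ne_zero A
  have h3 := hh.gl_denom_ne_zero (A * B)
  rw [moebius, moebius, div_eq_div_iff h3 h2, moebius]
  simp only [Matrix.GeneralLinearGroup.coe_mul, Matrix.mul_apply, Fin.sum_univ_two, map_add,
    map_mul]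
  field_simp
  ring

theorem moebius_one (h : RatFunc K) : moebius 1 h = h := by
  simp [moebius]

theorem moebius_inv_moebius {h : RatFunc K} (hh : Nonconst h) (A : GL (Fin 2) K) :
    moebius A⁻¹ (moebius A h) = h := by
  rw [← moebius_mul hh, inv_mul_cancel, moebius_one]

theorem map_moebius {L : Type*} [Field L] (A : GL (Fin 2) K) (B : GL (Fin 2) L)
    (σ : RatFunc K →+* RatFunc L) (hσ : ∀ i j, σ (RatFunc.C (A i j)) = RatFunc.C (B i j))
    (h : RatFunc K) : σ (moebius A h) = moebius B (σ h) := by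
  simp [moebius, hσ]

theorem algHom_C (σ : RatFunc K →ₐ[K] RatFunc K) (c : K) : σ (RatFunc.C c) = RatFunc.C c := by
  rw [← RatFunc.algebraMap_eq_C, AlgHom.commutes]

theorem algHom_moebius (σ : RatFunc K →ₐ[K] RatFunc K) (A : GL (Fin 2) K) (h : RatFunc K) :
    σ (moebius A h) = moebius A (σ h) :=
  map_moebius A A σ.toRingHom (fun _ _ => algHom_C σ _) h

theorem Nonconst.algHom {h : RatFunc K} (hh : Nonconst h) (σ : RatFunc K →ₐ[K] RatFunc K) :
    Nonconst (σ h) := by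
  rintro ⟨c, hc⟩
  exact hh ⟨c, σ.toRingHom.injective (hc.trans (algHom_C σ c).symm)⟩

theorem ringHom_eq_of_X {L : Type*} [Field L] {σ τ : RatFunc K →+* L}
    (hC : ∀ c, σ (RatFunc.C c) = τ (RatFunc.C c)) (hX : σ RatFunc.X = τ RatFunc.X) : σ = τ := by
  refine IsLocalization.ringHom_ext (nonZeroDivisors (Polynomial K)) ?_
  refine Polynomial.ringHom_ext (fun c => ?_) ?_
  · simpa using hC c
  · simpa using hX

theorem algHom_eq_of_X {σ τ : RatFunc K →ₐ[K] RatFunc K} (hX : σ RatFunc.X = τ RatFunc.X) :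
    σ = τ := by
  have : (σ : RatFunc K →+* RatFunc K) = τ :=
    ringHom_eq_of_X (fun c => by simp [algHom_C]) hX
  exact AlgHom.coe_ringHom_injective this

theorem algHom_algebraMap (σ : RatFunc K →ₐ[K] RatFunc K) (p : Polynomial K) :
    σ (algebraMap _ _ p) = p.aeval (σ RatFunc.X) := by
  rw [Polynomial.aeval_algHom_apply, RatFunc.aeval_X_left_eq_algebraMap]

/-- Composition on the right becomes a `K`-algebra endomorphism of `K(X)`, so identities about it
need checking only at `X`. -/
theorem comp_eq_algHom (σ : RatFunc K →ₐ[K] RatFunc K) (f : RatFunc K) :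
    comp f (σ RatFunc.X) = σ f := by
  conv_rhs => rw [← RatFunc.num_div_denom f, map_div₀, algHom_algebraMap, algHom_algebraMap]
  rfl

theorem nonconst_X : Nonconst (RatFunc.X : RatFunc K) := by
  rintro ⟨c, hc⟩
  rw [← RatFunc.algebraMap_X, ← RatFunc.algebraMap_C] at hc
  exact Polynomial.X_ne_C c (RatFunc.algebraMap_injective K hc)

theorem exists_algHom_of_nonconst {h : RatFunc K} (hh : Nonconst h) :
    ∃ σ : RatFunc K →ₐ[K] RatFunc K, σ RatFunc.X = h := by
  have ht : Transcendental K h := RatFunc.transcendental_of_ne_C h hh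
  have hinj : Function.Injective (Polynomial.aeval (R := K) h) :=
    transcendental_iff_injective.mp ht
  refine ⟨RatFunc.liftAlgHom (Polynomial.aeval h)
    (nonZeroDivisors_le_comap_nonZeroDivisors_of_injective _ hinj), ?_⟩
  have := RatFunc.liftAlgHom_apply_div (Polynomial.aeval (R := K) h)
    (nonZeroDivisors_le_comap_nonZeroDivisors_of_injective _ hinj) Polynomial.X 1
  simpa using this

/-- Substitution of a degree one function for `X`. -/
def substGL (φ : GL (Fin 2) K) : RatFunc K →ₐ[K] RatFunc K :=
  (exists_algHom_of_nonconst (nonconst_X.moebius φ)).choose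

theorem substGL_X (φ : GL (Fin 2) K) : substGL φ RatFunc.X = moebius φ RatFunc.X :=
  (exists_algHom_of_nonconst (nonconst_X.moebius φ)).choose_spec

theorem comp_moebius_X (φ : GL (Fin 2) K) (f : RatFunc K) :
    comp f (moebius φ RatFunc.X) = substGL φ f := by
  rw [← substGL_X, comp_eq_algHom]

/-- Substitution is contravariant, hence the reversed product. -/
theorem substGL_substGL (φ ψ : GL (Fin 2) K) (f : RatFunc K) :
    substGL φ (substGL ψ f) = substGL (ψ * φ) f := by
  have : (substGL φ).comp (substGL ψ) = substGL (ψ * φ) := by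
    refine algHom_eq_of_X ?_
    rw [AlgHom.comp_apply, substGL_X, substGL_X, algHom_moebius, substGL_X,
      moebius_mul nonconst_X]
  exact DFunLike.congr_fun this f

theorem substGL_one (f : RatFunc K) : substGL 1 f = f := by
  have : substGL (1 : GL (Fin 2) K) = AlgHom.id K _ :=
    algHom_eq_of_X (by rw [substGL_X, moebius_one, AlgHom.id_apply])
  rw [this, AlgHom.id_apply]

theorem equivalent_iff {f g : RatFunc K} :
    Equivalent f g ↔ ∃ ψ φ : GL (Fin 2) K, g = moebius ψ (substGL φ f) := by
  simp only [Equivalent, comp_moebius_X]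

theorem Equivalent.nonconst {f g : RatFunc K} (h : Equivalent f g) (hf : Nonconst f) :
    Nonconst g := by
  obtain ⟨ψ, φ, rfl⟩ := equivalent_iff.mp h
  exact (hf.algHom _).moebius _

theorem Equivalent.symm {f g : RatFunc K} (h : Equivalent f g) (hf : Nonconst f) :
    Equivalent g f := by
  obtain ⟨ψ, φ, rfl⟩ := equivalent_iff.mp h
  refine equivalent_iff.mpr ⟨ψ⁻¹, φ⁻¹, ?_⟩
  rw [algHom_moebius, substGL_substGL, mul_inv_cancel, substGL_one, moebius_inv_moebius hf]

theorem Equivalent.trans {f g h : RatFunc K} (h₁ : Equivalent f g) (h₂ : Equivalent g h)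
    (hf : Nonconst f) : Equivalent f h := by
  obtain ⟨ψ, φ, rfl⟩ := equivalent_iff.mp h₁
  obtain ⟨ψ', φ', rfl⟩ := equivalent_iff.mp h₂
  refine equivalent_iff.mpr ⟨ψ' * ψ, φ * φ', ?_⟩
  rw [algHom_moebius, substGL_substGL, moebius_mul (hf.algHom _)]

theorem nonconst_of_ratDegree_ne_zero {f : RatFunc K} (hf : ratDegree f ≠ 0) : Nonconst f := by
  rintro ⟨c, rfl⟩
  simp [ratDegree] at hf

end Moebius

/-! ### Extension of scalars -/

section BaseChange

variable {F : Type*} [Field F] (K : Type*) [Field K] [Algebra F K]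

theorem baseChange_algebraMap (p : Polynomial F) :
    baseChange K (algebraMap _ (RatFunc F) p) =
      algebraMap _ (RatFunc K) (p.map (algebraMap F K)) := by
  have := RatFunc.map_apply_div (Polynomial.mapRingHom (algebraMap F K))
    (nonZeroDivisors_le_comap_nonZeroDivisors_of_injective _
      (Polynomial.map_injective _ (algebraMap F K).injective)) p 1
  simpa [baseChange] using! this

theorem baseChange_C (c : F) : baseChange K (RatFunc.C c) = RatFunc.C (algebraMap F K c) := by
  rw [← RatFunc.algebraMap_C, baseChange_algebraMap, Polynomial.map_C, RatFunc.algebraMap_C]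

theorem baseChange_X : baseChange K (RatFunc.X : RatFunc F) = RatFunc.X := by
  rw [← RatFunc.algebraMap_X, baseChange_algebraMap, Polynomial.map_X, RatFunc.algebraMap_X]

/-- An invertible matrix over `F` viewed over an extension. -/
def glMap (A : GL (Fin 2) F) : GL (Fin 2) K := Matrix.GeneralLinearGroup.map (algebraMap F K) A

theorem glMap_apply (A : GL (Fin 2) F) (i j : Fin 2) : glMap K A i j = algebraMap F K (A i j) :=
  rfl

theorem baseChange_moebius (A : GL (Fin 2) F) (h : RatFunc F) :
    baseChange K (moebius A h) = moebius (glMap K A) (baseChange K h) :=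
  map_moebius _ _ _ (fun i j => by rw [baseChange_C, glMap_apply]) h

theorem baseChange_substGL (φ : GL (Fin 2) F) (f : RatFunc F) :
    baseChange K (substGL φ f) = substGL (glMap K φ) (baseChange K f) := by
  have : (baseChange K).comp (substGL φ : RatFunc F →+* RatFunc F) =
      ((substGL (glMap K φ) : RatFunc K →+* RatFunc K)).comp (baseChange K) := by
    refine ringHom_eq_of_X (fun c => ?_) ?_
    · simp [algHom_C, baseChange_C]
    · simp [substGL_X, baseChange_X, baseChange_moebius]
  exact RingHom.congr_fun this f

theorem Equivalent.baseChange {f g : RatFunc F} (h : Equivalent f g) :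
    Equivalent (baseChange K f) (baseChange K g) := by
  obtain ⟨ψ, φ, rfl⟩ := equivalent_iff.mp h
  exact equivalent_iff.mpr ⟨glMap K ψ, glMap K φ, by
    rw [baseChange_moebius, baseChange_substGL]⟩

theorem baseChange_fst (s t : F) :
    CubicRat.baseChange K (fst s t) = fst (algebraMap F K s) (algebraMap F K t) := by
  simp [fst, baseChange_X, baseChange_C]

end BaseChange

/-! ### Ramification through the Wronskian -/

section Ramification

variable {K : Type*} [Field K]

open Polynomial in
theorem X_sub_C_sq_dvd_iff {m : K[X]} {a : K} :
    (X - C a) ^ 2 ∣ m ↔ m.eval a = 0 ∧ m.derivative.eval a = 0 := by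
  constructor
  · rintro ⟨k, rfl⟩
    simp [sq, mul_assoc]
  · rintro ⟨h0, h1⟩
    obtain ⟨k, rfl⟩ := dvd_iff_isRoot.mpr h0
    rw [derivative_mul] at h1
    have hk : k.eval a = 0 := by simpa using h1
    obtain ⟨l, rfl⟩ := dvd_iff_isRoot.mpr hk
    exact ⟨l, by ring⟩

open Polynomial in
theorem algebraMap_ne_zero_of_eval {p : K[X]} {a : K} (hp : p.eval a ≠ 0) :
    algebraMap K[X] (RatFunc K) p ≠ 0 :=
  RatFunc.algebraMap_ne_zero fun h0 => hp (by rw [h0, eval_zero])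

open Polynomial in
/-- After composition with some degree one function on the left, `f` vanishes at `a` to order at
least two. -/
def Ram (f : RatFunc K) (a : K) : Prop :=
  ∃ (A : GL (Fin 2) K) (u v : K[X]), v.eval a ≠ 0 ∧
    moebius A f = algebraMap _ _ ((X - C a) ^ 2 * u) / algebraMap _ _ v

theorem ram_moebius {f : RatFunc K} (hf : Nonconst f) (A : GL (Fin 2) K) (a : K) :
    Ram (moebius A f) a ↔ Ram f a := by
  constructor
  · rintro ⟨B, u, v, hv, h⟩
    exact ⟨B * A, u, v, hv, by rw [moebius_mul hf, h]⟩
  · rintro ⟨B, u, v, hv, h⟩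
    exact ⟨B * A⁻¹, u, v, hv, by
      rw [← moebius_mul hf, inv_mul_cancel_right, h]⟩

-- A nonzero combination `α p + β r` has a double zero at `a` exactly when `(α, β)` is orthogonal to
-- both `(p(a), r(a))` and `(p'(a), r'(a))`. Such a pair exists iff these two vectors are dependent,
-- i.e. iff the Wronskian vanishes at `a`; then `(r(a), -p(a))` serves.
open Polynomial in
theorem ram_div_iff {p r : K[X]} {a : K}
    (hf : Nonconst (algebraMap K[X] (RatFunc K) p / algebraMap K[X] (RatFunc K) r))
    (hpr : p.eval a ≠ 0 ∨ r.eval a ≠ 0) :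
    Ram (algebraMap K[X] (RatFunc K) p / algebraMap K[X] (RatFunc K) r) a ↔
      p.derivative.eval a * r.eval a - p.eval a * r.derivative.eval a = 0 := by
  have hr : algebraMap K[X] (RatFunc K) r ≠ 0 := fun h0 => hf ⟨0, by simp [h0]⟩
  constructor
  · rintro ⟨A, u, v, hv, h⟩
    have hden := hf.gl_denom_ne_zero A
    have hv0 := algebraMap_ne_zero_of_eval hv
    have hP : (C (A 0 0) * p + C (A 0 1) * r) * v =
        (X - C a) ^ 2 * (u * (C (A 1 0) * p + C (A 1 1) * r)) := by
      apply RatFunc.algebraMap_injective K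
      rw [moebius, div_eq_div_iff hden hv0] at h
      simp only [map_mul, map_add, RatFunc.algebraMap_C] at h ⊢
      have hp := div_mul_cancel₀ (algebraMap K[X] (RatFunc K) p) hr
      generalize algebraMap K[X] (RatFunc K) p / algebraMap K[X] (RatFunc K) r = y at h hp
      rw [← hp]
      linear_combination algebraMap K[X] (RatFunc K) r * h
    have h2 := X_sub_C_sq_dvd_iff.mp ⟨_, hP⟩
    simp only [eval_mul, eval_add, eval_C, derivative_mul, derivative_add, derivative_C,
      zero_mul, zero_add, mul_eq_zero, hv, or_false] at h2
    obtain ⟨h0, h1⟩ := h2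
    rw [h0, zero_mul, add_zero] at h1
    have h1 := (mul_eq_zero.mp h1).resolve_right hv
    by_cases hA : A 0 0 = 0
    · have hB : A 0 1 ≠ 0 := fun hB => gl_det_ne_zero A (by rw [hA, hB]; ring)
      apply mul_left_cancel₀ hB
      linear_combination p.derivative.eval a * h0 - p.eval a * h1
    · apply mul_left_cancel₀ hA
      linear_combination r.eval a * h1 - r.derivative.eval a * h0
  · intro hW
    by_cases hra : r.eval a = 0
    · have hpa : p.eval a ≠ 0 := by tauto
      obtain ⟨u, hu⟩ : (X - C a) ^ 2 ∣ r := by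
        rw [X_sub_C_sq_dvd_iff]
        refine ⟨hra, ?_⟩
        rw [hra] at hW
        simpa [hpa] using hW
      refine ⟨mkGL 0 1 1 0 (by simp), u, p, hpa, ?_⟩
      rw [moebius_mkGL, ← hu]
      simp
    · obtain ⟨u, hu⟩ : (X - C a) ^ 2 ∣ C (r.eval a) * p - C (p.eval a) * r := by
        rw [X_sub_C_sq_dvd_iff]
        constructor
        · simp only [eval_sub, eval_mul, eval_C]
          ring
        · simp only [derivative_sub, derivative_mul, derivative_C, eval_sub, eval_mul, eval_C,
            eval_add, eval_zero]
          linear_combination hW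
      refine ⟨mkGL (r.eval a) (-p.eval a) 0 1 (by simpa using hra), u, r, hra, ?_⟩
      rw [moebius_mkGL, ← hu]
      simp only [map_sub, map_mul, RatFunc.algebraMap_C, map_zero, map_one, map_neg]
      rw [zero_mul, zero_add, div_one, sub_div, mul_div_assoc, mul_div_cancel_right₀ _ hr,
        sub_eq_add_neg]

-- Allows a fraction that need not be reduced: `Q` is prime to `X - a`, so cancellation does not
-- affect the order at `a`.
open Polynomial in
theorem one_lt_rootMultiplicity_num_iff {y : RatFunc K} {P Q : K[X]} {a : K} (hy : y ≠ 0)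
    (h : y = algebraMap K[X] (RatFunc K) P / algebraMap K[X] (RatFunc K) Q)
    (hQ : Q.eval a ≠ 0) :
    1 < y.num.rootMultiplicity a ↔ (X - C a) ^ 2 ∣ P := by
  have hQ0 : Q ≠ 0 := by rintro rfl; simp at hQ
  rw [← Nat.succ_le_iff, le_rootMultiplicity_iff (RatFunc.num_ne_zero hy)]
  have key : y.num * Q = P * y.denom := by
    apply RatFunc.algebraMap_injective K
    have h1 := RatFunc.num_div_denom y
    have h2 : algebraMap K[X] (RatFunc K) y.denom ≠ 0 := by
      simpa using y.denom_ne_zero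
    have h3 : algebraMap K[X] (RatFunc K) Q ≠ 0 := by simpa using hQ0
    rw [map_mul, map_mul, ← div_eq_div_iff h2 h3, h1, h]
  constructor
  · intro hd
    have : y.num ∣ P := by
      rw [h]; exact RatFunc.num_div_dvd P hQ0
    exact hd.trans this
  · intro hd
    have h1 : (X - C a) ^ 2 ∣ y.num * Q := key ▸ hd.mul_right _
    refine IsCoprime.dvd_of_dvd_mul_right ?_ h1
    refine IsCoprime.pow_left ?_
    refine (irreducible_X_sub_C a).coprime_iff_not_dvd.mpr ?_
    rw [dvd_iff_isRoot]
    exact hQ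

open Polynomial in
theorem one_lt_ramIdxAt_iff {f : RatFunc K} (hf : Nonconst f) (a : K) :
    1 < ramIdxAt f a ↔ Ram f a := by
  have hnd := RatFunc.num_div_denom f
  have hco : f.num.eval a ≠ 0 ∨ f.denom.eval a ≠ 0 := by
    by_contra! h0
    obtain ⟨x, y, hxy⟩ := RatFunc.isCoprime_num_denom f
    have := congrArg (eval a) hxy
    simp [h0.1, h0.2] at this
  have hR := ram_div_iff (p := f.num) (r := f.denom) (a := a) (by rwa [hnd]) hco
  rw [hnd] at hR
  rw [hR]
  have hd0 : algebraMap K[X] (RatFunc K) f.denom ≠ 0 := by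
    simpa using f.denom_ne_zero
  by_cases hd : f.denom.eval a = 0
  · have hn : f.num.eval a ≠ 0 := by tauto
    have hv : valAt f a = none := by rw [valAt, if_pos hd]; rfl
    have hfi : f⁻¹ ≠ 0 := inv_ne_zero fun h0 => hf ⟨0, by simpa using h0⟩
    have : ramIdxAt f a = (f⁻¹).num.rootMultiplicity a := by
      unfold ramIdxAt; rw [hv]
    rw [this, one_lt_rootMultiplicity_num_iff (P := f.denom) (Q := f.num) hfi
      (by conv_lhs => rw [← hnd, inv_div]) hn, X_sub_C_sq_dvd_iff, hd]
    simp [hn]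
  · have hv : valAt f a = some (f.num.eval a / f.denom.eval a) := by
      rw [valAt, if_neg hd]; rfl
    set b := f.num.eval a / f.denom.eval a with hb
    have : ramIdxAt f a = (f - RatFunc.C b).num.rootMultiplicity a := by
      unfold ramIdxAt; rw [hv]
    have hb' : b * f.denom.eval a = f.num.eval a := by rw [hb]; field_simp
    rw [this, one_lt_rootMultiplicity_num_iff (P := f.num - C b * f.denom) (Q := f.denom)
      (sub_ne_zero.mpr fun h0 => hf ⟨b, h0⟩)
      (by
        rw [map_sub, sub_div, hnd, map_mul, mul_div_cancel_right₀ _ hd0, RatFunc.algebraMap_C])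
      hd, X_sub_C_sq_dvd_iff]
    simp only [eval_sub, eval_mul, eval_C, hb', sub_self, true_and, derivative_sub,
      derivative_mul, derivative_C, zero_mul, zero_add]
    rw [← hb', ← mul_right_inj' hd]
    ring_nf

/-! ### Ramification under change of coordinates, including the point at infinity -/

section Action

open Classical in
theorem smul_coe_eq_coe_iff (φ : GL (Fin 2) K) (a b : K) :
    φ • (a : OnePoint K) = (b : OnePoint K) ↔
      φ 1 0 * a + φ 1 1 ≠ 0 ∧ φ 0 0 * a + φ 0 1 = b * (φ 1 0 * a + φ 1 1) := by
  rw [OnePoint.smul_some_eq_ite]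
  split_ifs with h
  · simp [h]
  · rw [OnePoint.coe_eq_coe, div_eq_iff h]
    simp [h]

open Polynomial Classical in
theorem Ram.substGL {f : RatFunc K} {φ : GL (Fin 2) K} {a b : K}
    (hab : φ • (a : OnePoint K) = (b : OnePoint K)) (h : Ram f b) : Ram (substGL φ f) a := by
  obtain ⟨hd, hb⟩ := (smul_coe_eq_coe_iff φ a b).mp hab
  have hX : CubicRat.substGL φ RatFunc.X = algebraMap K[X] (RatFunc K) (C (φ 0 0) * X + C (φ 0 1)) /
      algebraMap K[X] (RatFunc K) (C (φ 1 0) * X + C (φ 1 1)) := by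
    rw [substGL_X, moebius]
    simp
  have hden : (C (φ 1 0) * X + C (φ 1 1) : K[X]).eval a ≠ 0 := by simpa using hd
  have ne (p : K[X]) (hp : p.eval a ≠ 0) : algebraMap K[X] (RatFunc K) p ≠ 0 :=
    algebraMap_ne_zero_of_eval hp
  -- The pullback of a polynomial has no pole at `a`, and its value there is that of `p` at `b`.
  have reg (p : K[X]) : ∃ U V : K[X], V.eval a ≠ 0 ∧ U.eval a = p.eval b * V.eval a ∧
      CubicRat.substGL φ (algebraMap _ _ p) =
        algebraMap K[X] (RatFunc K) U / algebraMap K[X] (RatFunc K) V := by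
    induction p using Polynomial.induction_on' with
    | add p q hp hq =>
      obtain ⟨U, V, hV, hU, h1⟩ := hp
      obtain ⟨U', V', hV', hU', h1'⟩ := hq
      refine ⟨U * V' + V * U', V * V', by simp [hV, hV'], ?_, ?_⟩
      · simp only [eval_add, eval_mul, hU, hU']
        ring
      · rw [map_add, map_add, h1, h1', div_add_div _ _ (ne _ hV) (ne _ hV')]
        simp
    | monomial n c =>
      refine ⟨C c * (C (φ 0 0) * X + C (φ 0 1)) ^ n, (C (φ 1 0) * X + C (φ 1 1)) ^ n,
        by rw [eval_pow]; exact pow_ne_zero _ hden, ?_, ?_⟩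
      · simp only [eval_mul, eval_pow, eval_C, eval_monomial, eval_add, eval_X, hb, mul_pow]
        ring
      · rw [← C_mul_X_pow_eq_monomial, map_mul, map_mul, map_pow, map_pow, RatFunc.algebraMap_X,
          hX, RatFunc.algebraMap_C, algHom_C, div_pow, map_mul, map_pow, map_pow,
          RatFunc.algebraMap_C, mul_div_assoc]
  obtain ⟨A, u, v, hv, h⟩ := h
  obtain ⟨U, V, hV, -, hu⟩ := reg u
  obtain ⟨U', V', hV', hU', hv'⟩ := reg v
  have hU0 : U'.eval a ≠ 0 := by rw [hU']; exact mul_ne_zero hv hV'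
  refine ⟨A, C (φ 0 0 * φ 1 1 - φ 0 1 * φ 1 0) ^ 2 * U * V',
    (C (φ 1 0) * X + C (φ 1 1)) ^ 2 * C (φ 1 0 * a + φ 1 1) ^ 2 * V * U', ?_, ?_⟩
  · rw [eval_mul, eval_mul, eval_mul, eval_pow, eval_pow, eval_C]
    exact mul_ne_zero (mul_ne_zero (mul_ne_zero (pow_ne_zero _ hden) (pow_ne_zero _ hd)) hV) hU0
  · have hlin : CubicRat.substGL φ (algebraMap _ _ (X - C b)) =
        algebraMap K[X] (RatFunc K) ((X - C a) * C (φ 0 0 * φ 1 1 - φ 0 1 * φ 1 0)) /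
        algebraMap K[X] (RatFunc K) ((C (φ 1 0) * X + C (φ 1 1)) * C (φ 1 0 * a + φ 1 1)) := by
      rw [map_sub, map_sub, RatFunc.algebraMap_X, RatFunc.algebraMap_C, algHom_C, hX,
        ← RatFunc.algebraMap_C, div_sub' (ne _ hden), map_mul (algebraMap K[X] (RatFunc K))
          (C (φ 1 0) * X + C (φ 1 1)),
        div_eq_div_iff (ne _ hden)
          (mul_ne_zero (ne _ hden) (ne _ (by rwa [eval_C])))]
      simp only [← map_mul, ← map_sub]
      congr 1
      have hb' : C (φ 0 0) * C a + C (φ 0 1) = C b * (C (φ 1 0) * C a + C (φ 1 1)) := by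
        simp only [← C_mul, ← C_add, hb]
      simp only [C_mul, C_sub, C_add]
      linear_combination (C (φ 1 0) * X + C (φ 1 1)) ^ 2 * hb'
    have aux (x δ D e u v u' v' : RatFunc K) : ((x * δ) / (D * e)) ^ 2 * (u / v) / (u' / v') =
        x ^ 2 * (δ ^ 2 * u * v') / (D ^ 2 * e ^ 2 * v * u') := by
      rw [div_pow, div_mul_div_comm, div_div_div_eq]
      congr 1 <;> ring
    have h' := congrArg (CubicRat.substGL φ) h
    rw [algHom_moebius, map_div₀, map_mul (algebraMap K[X] (RatFunc K)), map_mul,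
      map_pow (algebraMap K[X] (RatFunc K)), map_pow, hlin, hu, hv',
      map_mul (algebraMap K[X] (RatFunc K)), map_mul (algebraMap K[X] (RatFunc K)), aux] at h'
    rw [h']
    simp only [map_mul (algebraMap K[X] (RatFunc K)), map_pow (algebraMap K[X] (RatFunc K))]

open Classical in
theorem ram_substGL_iff {f : RatFunc K} {φ : GL (Fin 2) K} {a b : K}
    (hab : φ • (a : OnePoint K) = (b : OnePoint K)) : Ram (substGL φ f) a ↔ Ram f b := by
  refine ⟨fun h => ?_, Ram.substGL hab⟩
  have h2 : φ⁻¹ • (b : OnePoint K) = (a : OnePoint K) := by rw [← hab, inv_smul_smul]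
  have := h.substGL h2
  rwa [substGL_substGL, mul_inv_cancel, substGL_one] at this

/-- The inversion `1/X`. -/
def swapGL : GL (Fin 2) K := mkGL 0 1 1 0 (by simp)

theorem comp_X_inv (f : RatFunc K) : comp f RatFunc.X⁻¹ = substGL swapGL f := by
  rw [← comp_moebius_X, swapGL, moebius_mkGL]
  simp

open Classical in
theorem swapGL_smul_zero :
    (swapGL : GL (Fin 2) K) • ((0 : K) : OnePoint K) = OnePoint.infty := by
  rw [OnePoint.smul_some_eq_ite]
  simp [swapGL, mkGL, Matrix.GeneralLinearGroup.mkOfDetNeZero]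

-- Any chart sending a finite point `b` to `a` detects ramification at `a`. This treats infinity,
-- where the definition uses the chart `1/X` at `0`, on the same footing as finite points.
open Classical in
theorem mem_ramSet_iff {f : RatFunc K} (hf : Nonconst f) {χ : GL (Fin 2) K} {b : K}
    {a : OnePoint K} (hab : χ • (b : OnePoint K) = a) :
    a ∈ ramSet f ↔ Ram (substGL χ f) b := by
  induction a using OnePoint.rec with
  | infty =>
    have h1 : OnePoint.infty ∈ ramSet f ↔ 1 < ramIdxAt (comp f RatFunc.X⁻¹) 0 := Iff.rfl
    rw [h1, comp_X_inv, one_lt_ramIdxAt_iff (hf.algHom _)]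
    have h2 : χ = swapGL * (swapGL⁻¹ * χ) := by simp
    rw [h2, ← substGL_substGL]
    refine (ram_substGL_iff ?_).symm
    rw [mul_smul, hab, ← swapGL_smul_zero, inv_smul_smul]
  | coe a =>
    have h1 : (a : OnePoint K) ∈ ramSet f ↔ 1 < ramIdxAt f a := Iff.rfl
    rw [h1, one_lt_ramIdxAt_iff hf, ram_substGL_iff hab]

open Classical in
theorem mem_ramSet_moebius_substGL {f : RatFunc K} (hf : Nonconst f) (ψ φ : GL (Fin 2) K)
    (a : OnePoint K) : a ∈ ramSet (moebius ψ (substGL φ f)) ↔ φ • a ∈ ramSet f := by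
  obtain ⟨χ, b, hab⟩ : ∃ (χ : GL (Fin 2) K) (b : K), χ • (b : OnePoint K) = a := by
    induction a using OnePoint.rec with
    | infty => exact ⟨swapGL, 0, swapGL_smul_zero⟩
    | coe a => exact ⟨1, a, one_smul _ _⟩
  have h2 : (φ * χ) • (b : OnePoint K) = φ • a := by rw [mul_smul, hab]
  rw [mem_ramSet_iff ((hf.algHom _).moebius _) hab, mem_ramSet_iff hf h2, algHom_moebius,
    ram_moebius ((hf.algHom _).algHom _), substGL_substGL]

end Action

/-! ### Ramification points of `fst s t` -/

section Fst

open Polynomial in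
theorem fst_eq_div (s t : K) : fst s t =
    algebraMap K[X] (RatFunc K) (X ^ 3 + C s * X + C t) /
      algebraMap K[X] (RatFunc K) (X ^ 2 - X) := by
  simp only [fst, map_add, map_mul, map_pow, map_sub, RatFunc.algebraMap_X, RatFunc.algebraMap_C]
  congr 1
  ring

open Polynomial in
theorem fst_nonconst (s t : K) : Nonconst (fst s t) := by
  have h0 : (X ^ 2 - X : K[X]) ≠ 0 := by
    intro h
    have := congrArg (coeff · 2) h
    simp [coeff_X] at this
  refine nonconst_of_linear_indep (fst_eq_div s t) (RatFunc.algebraMap_ne_zero h0) fun c hc => ?_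
  rw [← RatFunc.algebraMap_C, ← map_mul] at hc
  have := congrArg (coeff · 3) (RatFunc.algebraMap_injective K hc)
  simp [mul_sub] at this

-- `gst s t` is the Wronskian of numerator and denominator. The conditions on `s` and `t` say that
-- the numerator does not vanish at the zeros `0` and `1` of the denominator.
open Polynomial in
theorem ram_fst_iff {s t : K} (ht : t ≠ 0) (hst : 1 + s + t ≠ 0) (a : K) :
    Ram (fst s t) a ↔ (gst s t).eval a = 0 := by
  have hn := fst_nonconst s t
  rw [fst_eq_div] at hn ⊢
  rw [ram_div_iff hn]
  · have : (gst s t).eval a = (X ^ 3 + C s * X + C t : K[X]).derivative.eval a *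
      (X ^ 2 - X : K[X]).eval a - (X ^ 3 + C s * X + C t : K[X]).eval a *
      (X ^ 2 - X : K[X]).derivative.eval a := by
      simp [gst]
      ring
    rw [this]
  · by_contra! h
    simp only [eval_add, eval_pow, eval_X, eval_mul, eval_C, eval_sub] at h
    obtain ⟨h1, h2⟩ := h
    have h3 : a * (a - 1) = 0 := by linear_combination h2
    rcases mul_eq_zero.mp h3 with h4 | h4
    · rw [h4] at h1
      exact ht (by linear_combination h1)
    · rw [sub_eq_zero.mp h4] at h1
      exact hst (by linear_combination h1)

open Polynomial in
theorem substGL_swapGL_fst (s t : K) : substGL swapGL (fst s t) =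
    algebraMap K[X] (RatFunc K) (1 + C s * X ^ 2 + C t * X ^ 3) /
      algebraMap K[X] (RatFunc K) (X - X ^ 2) := by
  have hX : substGL swapGL (RatFunc.X : RatFunc K) = RatFunc.X⁻¹ := by
    rw [substGL_X, swapGL, moebius_mkGL]
    simp
  have h0 : (RatFunc.X : RatFunc K) ≠ 0 := RatFunc.X_ne_zero
  have h1 : (RatFunc.X : RatFunc K) - 1 ≠ 0 := by
    have := nonconst_X.linear_ne_zero (K := K) (c := 1) (d := -1) (by simp)
    simpa [sub_eq_add_neg] using this
  have h2 : (1 : RatFunc K) - RatFunc.X ≠ 0 := by rwa [← neg_ne_zero, neg_sub]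
  have h3 : (RatFunc.X : RatFunc K) - RatFunc.X ^ 2 ≠ 0 := by
    rw [show (RatFunc.X : RatFunc K) - RatFunc.X ^ 2 = RatFunc.X * (1 - RatFunc.X) by ring]
    exact mul_ne_zero h0 h2
  simp only [fst, map_div₀, map_add, map_mul, map_sub, map_pow, map_one, hX, algHom_C,
    RatFunc.algebraMap_X, RatFunc.algebraMap_C]
  rw [eq_div_iff h3]
  field_simp

open Polynomial in
theorem mem_ramSet_fst {s t : K} (ht : t ≠ 0) (hst : 1 + s + t ≠ 0) (a : OnePoint K) :
    a ∈ ramSet (fst s t) ↔ ∃ x : K, a = x ∧ (gst s t).eval x = 0 := by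
  classical
  induction a using OnePoint.rec with
  | infty =>
    have hn := (fst_nonconst s t).algHom (substGL swapGL)
    rw [mem_ramSet_iff (fst_nonconst s t) swapGL_smul_zero]
    rw [substGL_swapGL_fst] at hn ⊢
    -- In the chart `1/X` the Wronskian at `0` is `-1`: the pole at infinity is simple.
    rw [ram_div_iff hn (by simp)]
    simp [OnePoint.infty_ne_coe]
  | coe a =>
    rw [mem_ramSet_iff (fst_nonconst s t) (one_smul (GL (Fin 2) K) (a : OnePoint K)), substGL_one,
      ram_fst_iff ht hst]
    simp

end Fst

end Ramification

/-! ### Conjugate ramification points over a finite field -/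

section Lambda

variable {F : Type*} [Field F]

/-- The ramification points of `f` over the algebraic closure are the four distinct points
`ρ₁, ρ₁^q, ρ₂, ρ₂^q`, of degree two over `F`. -/
def RamPts (f : RatFunc F) (ρ₁ ρ₂ : AlgebraicClosure F) : Prop :=
  (ρ₁ ^ Nat.card F) ^ Nat.card F = ρ₁ ∧ (ρ₂ ^ Nat.card F) ^ Nat.card F = ρ₂ ∧
    ρ₁ ^ Nat.card F ≠ ρ₁ ∧ ρ₂ ^ Nat.card F ≠ ρ₂ ∧ ρ₂ ≠ ρ₁ ∧ ρ₂ ≠ ρ₁ ^ Nat.card F ∧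
    ∀ a : OnePoint (AlgebraicClosure F), a ∈ ramSet (baseChange (AlgebraicClosure F) f) ↔
      a = ρ₁ ∨ a = (ρ₁ ^ Nat.card F : AlgebraicClosure F) ∨ a = ρ₂ ∨
        a = (ρ₂ ^ Nat.card F : AlgebraicClosure F)

theorem isLambda_iff {f : RatFunc F} {c : AlgebraicClosure F} :
    IsLambda f c ↔ ∃ ρ₁ ρ₂, RamPts f ρ₁ ρ₂ ∧
      c = crossRatio ρ₁ (ρ₁ ^ Nat.card F) ρ₂ (ρ₂ ^ Nat.card F) +
      (crossRatio ρ₁ (ρ₁ ^ Nat.card F) ρ₂ (ρ₂ ^ Nat.card F))⁻¹ := by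
  simp only [IsLambda, RamPts, Set.ext_iff, Set.image_insert_eq, Set.image_singleton,
    Set.mem_insert_iff, Set.mem_singleton_iff, and_assoc]

theorem RamPts.swap {f : RatFunc F} {ρ₁ ρ₂ : AlgebraicClosure F} (h : RamPts f ρ₁ ρ₂) :
    RamPts f ρ₂ ρ₁ := by
  obtain ⟨h1, h2, h3, h4, h5, h6, h7⟩ := h
  refine ⟨h2, h1, h4, h3, h5.symm, fun h => h6 ?_, fun a => ?_⟩
  · rw [h, h2]
  · rw [h7]
    tauto

theorem RamPts.frob_left {f : RatFunc F} {ρ₁ ρ₂ : AlgebraicClosure F} (h : RamPts f ρ₁ ρ₂) :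
    RamPts f (ρ₁ ^ Nat.card F) ρ₂ := by
  obtain ⟨h1, h2, h3, h4, h5, h6, h7⟩ := h
  refine ⟨by rw [h1], h2, by rw [h1]; exact h3.symm, h4, h6, by rwa [h1], fun a => ?_⟩
  rw [h7, h1]
  tauto

theorem ClassIIIb.nonconst {f : RatFunc F} (hf : ClassIIIb f) : Nonconst f :=
  nonconst_of_ratDegree_ne_zero (by rw [hf.1.1]; norm_num)

theorem ClassIIIb.nonconst_baseChange {f : RatFunc F} (hf : ClassIIIb f) :
    Nonconst (baseChange (AlgebraicClosure F) f) := by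
  obtain ⟨s, t, -, -, he, -⟩ := hf.2
  refine ((he.symm hf.nonconst).baseChange _).nonconst ?_
  rw [baseChange_fst]
  exact fst_nonconst _ _

theorem RamPts.lambda_eq {f : RatFunc F} {ρ₁ ρ₂ : AlgebraicClosure F} (h : RamPts f ρ₁ ρ₂) :
    lambda f = crossRatio ρ₁ (ρ₁ ^ Nat.card F) ρ₂ (ρ₂ ^ Nat.card F) +
      (crossRatio ρ₁ (ρ₁ ^ Nat.card F) ρ₂ (ρ₂ ^ Nat.card F))⁻¹ := by
  have h' : IsLambda f _ := isLambda_iff.mpr ⟨ρ₁, ρ₂, h, rfl⟩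
  exact IsLambda.unique (Classical.epsilon_spec ⟨_, h'⟩) h'

variable [Finite F]

theorem exists_frobenius : ∃ σ : AlgebraicClosure F →ₐ[F] AlgebraicClosure F,
    ∀ x, σ x = x ^ Nat.card F := by
  have := Fintype.ofFinite F
  exact ⟨FiniteField.frobeniusAlgHom F _, fun x => by simp [Nat.card_eq_fintype_card]⟩

-- `X^q - X` already splits over `F`, so an extension contains no further roots.
open Polynomial in
theorem exists_algebraMap_of_pow_card {L : Type*} [Field L] [Algebra F L] {x : L}
    (hx : x ^ Nat.card F = x) : ∃ c, algebraMap F L c = x := by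
  have := Fintype.ofFinite F
  have h := FiniteField.X_pow_card_sub_X_ne_zero F (Finite.one_lt_card (α := F))
  have hs : (X ^ Nat.card F - X : F[X]).Splits := by
    rw [splits_iff_card_roots, Nat.card_eq_fintype_card, FiniteField.roots_X_pow_card_sub_X,
      FiniteField.X_pow_card_sub_X_natDegree_eq F Fintype.one_lt_card]
    rfl
  have h0 : ((X ^ Nat.card F - X : F[X]).map (algebraMap F L)).IsRoot x := by
    simp only [Polynomial.map_sub, Polynomial.map_pow, map_X, IsRoot, eval_sub, eval_pow, eval_X,
      hx, sub_self]
  exact hs.mem_range_of_isRoot h h0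

open Polynomial in
theorem exists_conjugate_roots {P : F[X]} (hP : P.Monic) (hdeg : P.natDegree = 2)
    (hirr : Irreducible P) : ∃ ρ : AlgebraicClosure F, ρ ^ Nat.card F ≠ ρ ∧
      (ρ ^ Nat.card F) ^ Nat.card F = ρ ∧
      P.map (algebraMap F (AlgebraicClosure F)) = (X - C ρ) * (X - C (ρ ^ Nat.card F)) := by
  obtain ⟨σ, hσ⟩ := exists_frobenius (F := F)
  obtain ⟨ρ, hρ⟩ := IsAlgClosed.exists_aeval_eq_zero (AlgebraicClosure F) P
    (degree_pos_of_irreducible hirr).ne'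
  have root_σ {x : AlgebraicClosure F} (hx : aeval x P = 0) : aeval (x ^ Nat.card F) P = 0 := by
    rw [← hσ, aeval_algHom_apply, hx, map_zero]
  have hne : ρ ^ Nat.card F ≠ ρ := by
    intro h
    obtain ⟨c, rfl⟩ := exists_algebraMap_of_pow_card h
    rw [aeval_algebraMap_apply, map_eq_zero] at hρ
    have h1 := degree_eq_one_of_irreducible_of_root (x := c) hirr hρ
    rw [degree_eq_natDegree hP.ne_zero, hdeg] at h1
    norm_num at h1
  have hmap : P.map (algebraMap F (AlgebraicClosure F)) =
      (X - C ρ) * (X - C (ρ ^ Nat.card F)) := by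
    refine eq_of_monic_of_dvd_of_natDegree_le
      ((monic_X_sub_C _).mul (monic_X_sub_C _)) (hP.map _) ?_ ?_
    · refine IsCoprime.mul_dvd (isCoprime_X_sub_C_of_isUnit_sub
        (sub_ne_zero.mpr hne.symm).isUnit) ?_ ?_
      · rwa [dvd_iff_isRoot, IsRoot, eval_map_algebraMap]
      · rw [dvd_iff_isRoot, IsRoot, eval_map_algebraMap]
        exact root_σ hρ
    · rw [natDegree_map, hdeg, natDegree_mul (X_sub_C_ne_zero _) (X_sub_C_ne_zero _),
        natDegree_X_sub_C, natDegree_X_sub_C]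
  refine ⟨ρ, hne, ?_, hmap⟩
  have h2 : aeval ((ρ ^ Nat.card F) ^ Nat.card F) P = 0 := root_σ (root_σ hρ)
  rw [← eval_map_algebraMap, hmap, eval_mul, mul_eq_zero] at h2
  rcases h2 with h2 | h2
  · simpa [sub_eq_zero] using h2
  · have h3 : (ρ ^ Nat.card F) ^ Nat.card F = ρ ^ Nat.card F := by
      simpa [sub_eq_zero] using h2
    rw [← hσ, ← hσ] at h3
    exact absurd (σ.injective h3) (by rwa [hσ])

-- A matrix over `F` commutes with Frobenius. The image of `x` is finite: subtracting `cx + d = 0`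
-- from its conjugate gives `c(x^q - x) = 0`, hence `c = d = 0`.
open Classical in
theorem smul_conjugates (A : GL (Fin 2) F) {x : AlgebraicClosure F}
    (hx : x ^ Nat.card F ≠ x) : ∃ y : AlgebraicClosure F,
      glMap (AlgebraicClosure F) A • (x : OnePoint (AlgebraicClosure F)) = y ∧
      glMap (AlgebraicClosure F) A •
        ((x ^ Nat.card F : AlgebraicClosure F) : OnePoint (AlgebraicClosure F)) =
          (y ^ Nat.card F : AlgebraicClosure F) := by
  obtain ⟨σ, hσ⟩ := exists_frobenius (F := F)
  have hden : algebraMap F (AlgebraicClosure F) (A 1 0) * x +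
      algebraMap F (AlgebraicClosure F) (A 1 1) ≠ 0 := by
    intro h
    have h' := congrArg σ h
    rw [map_add, map_mul, AlgHom.commutes, AlgHom.commutes, map_zero] at h'
    have h2 : algebraMap F (AlgebraicClosure F) (A 1 0) * (σ x - x) = 0 := by
      linear_combination h' - h
    rw [mul_eq_zero, sub_eq_zero, hσ] at h2
    have hc := h2.resolve_right hx
    rw [hc, zero_mul, zero_add, map_eq_zero] at h
    rw [map_eq_zero] at hc
    exact gl_det_ne_zero A (by rw [hc, h]; ring)
  have hy := div_mul_cancel₀ (algebraMap F (AlgebraicClosure F) (A 0 0) * x +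
      algebraMap F (AlgebraicClosure F) (A 0 1)) hden
  generalize (algebraMap F (AlgebraicClosure F) (A 0 0) * x +
      algebraMap F (AlgebraicClosure F) (A 0 1)) / (algebraMap F (AlgebraicClosure F) (A 1 0) * x +
      algebraMap F (AlgebraicClosure F) (A 1 1)) = y at hy
  refine ⟨y, ?_, ?_⟩
  · rw [smul_coe_eq_coe_iff]
    exact ⟨hden, hy.symm⟩
  · rw [smul_coe_eq_coe_iff, ← hσ, ← hσ]
    have h1 := congrArg σ hy
    have h2 := (map_ne_zero σ).mpr hden
    simp only [map_add, map_mul, AlgHom.commutes] at h1 h2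
    exact ⟨h2, h1.symm⟩

open Polynomial in
theorem exists_ramPts_fst {s t : F} (ht : t ≠ 0) (hst : 1 + s + t ≠ 0) {P Q : F[X]}
    (hP : P.Monic) (hQ : Q.Monic) (hP2 : P.natDegree = 2) (hQ2 : Q.natDegree = 2)
    (hPi : Irreducible P) (hQi : Irreducible Q) (hPQ : P ≠ Q) (hG : gst s t = P * Q) :
    ∃ ρ₁ ρ₂, RamPts (fst s t) ρ₁ ρ₂ ∧
      gst (algebraMap F (AlgebraicClosure F) s) (algebraMap F (AlgebraicClosure F) t) =
        (X - C ρ₁) * (X - C (ρ₁ ^ Nat.card F)) * ((X - C ρ₂) * (X - C (ρ₂ ^ Nat.card F))) := by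
  obtain ⟨ρ₁, h1, h1', hm1⟩ := exists_conjugate_roots hP hP2 hPi
  obtain ⟨ρ₂, h2, h2', hm2⟩ := exists_conjugate_roots hQ hQ2 hQi
  have hg : gst (algebraMap F (AlgebraicClosure F) s) (algebraMap F (AlgebraicClosure F) t) =
      (X - C ρ₁) * (X - C (ρ₁ ^ Nat.card F)) * ((X - C ρ₂) * (X - C (ρ₂ ^ Nat.card F))) := by
    rw [← hm1, ← hm2, ← Polynomial.map_mul, ← hG]
    simp [gst]
  have hdisj (x : AlgebraicClosure F) (hxP : aeval x P = 0) (hxQ : aeval x Q = 0) : False :=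
    hPQ ((minpoly.eq_of_irreducible_of_monic hPi hxP hP).trans
      (minpoly.eq_of_irreducible_of_monic hQi hxQ hQ).symm)
  have hρ2 : aeval ρ₂ Q = 0 := by
    rw [← eval_map_algebraMap, hm2]
    simp
  have hP' (x : AlgebraicClosure F) : aeval x P = (x - ρ₁) * (x - ρ₁ ^ Nat.card F) := by
    rw [← eval_map_algebraMap, hm1]
    simp
  refine ⟨ρ₁, ρ₂, ⟨h1', h2', h1, h2, ?_, ?_, fun a => ?_⟩, hg⟩
  · intro h
    exact hdisj ρ₂ (by rw [hP', h, sub_self, zero_mul]) hρ2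
  · intro h
    exact hdisj ρ₂ (by rw [hP', h, sub_self, mul_zero]) hρ2
  · have ht' : algebraMap F (AlgebraicClosure F) t ≠ 0 := by simpa using ht
    have hst' : 1 + algebraMap F (AlgebraicClosure F) s +
        algebraMap F (AlgebraicClosure F) t ≠ 0 := by
      rw [← map_one (algebraMap F (AlgebraicClosure F)), ← map_add, ← map_add]
      exact (_root_.map_ne_zero _).mpr hst
    rw [baseChange_fst, mem_ramSet_fst ht' hst', hg]
    simp only [eval_mul, eval_sub, eval_X, eval_C, mul_eq_zero, sub_eq_zero]
    constructor
    · rintro ⟨x, rfl, (h | h) | h | h⟩ <;> simp [h]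
    · rintro (rfl | rfl | rfl | rfl)
      exacts [⟨_, rfl, by simp⟩, ⟨_, rfl, by simp⟩, ⟨_, rfl, by simp⟩, ⟨_, rfl, by simp⟩]

theorem RamPts.of_equivalent {f g : RatFunc F} (hfg : Equivalent f g)
    (hf : Nonconst (baseChange (AlgebraicClosure F) f)) {ρ₁ ρ₂ : AlgebraicClosure F}
    (h : RamPts f ρ₁ ρ₂) : ∃ ρ₁' ρ₂', RamPts g ρ₁' ρ₂' := by
  classical
  obtain ⟨ψ, φ, rfl⟩ := equivalent_iff.mp hfg
  obtain ⟨h1, h2, h3, h4, h5, h6, h7⟩ := h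
  have h3' : (ρ₁ ^ Nat.card F) ^ Nat.card F ≠ ρ₁ ^ Nat.card F := by rw [h1]; exact h3.symm
  have h4' : (ρ₂ ^ Nat.card F) ^ Nat.card F ≠ ρ₂ ^ Nat.card F := by rw [h2]; exact h4.symm
  obtain ⟨y₁, ha, hb⟩ := smul_conjugates φ⁻¹ h3
  obtain ⟨y₂, hc, hd⟩ := smul_conjugates φ⁻¹ h4
  -- A second application, at the conjugate points, shows that the images are fixed by the square of
  -- Frobenius.
  obtain ⟨z₁, he, hf'⟩ := smul_conjugates φ⁻¹ h3'
  obtain ⟨z₂, hg, hh⟩ := smul_conjugates φ⁻¹ h4'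
  rw [hb, OnePoint.coe_eq_coe] at he
  rw [hd, OnePoint.coe_eq_coe] at hg
  subst he hg
  rw [h1, ha, OnePoint.coe_eq_coe] at hf'
  rw [h2, hc, OnePoint.coe_eq_coe] at hh
  have hinv : glMap (AlgebraicClosure F) φ⁻¹ = (glMap (AlgebraicClosure F) φ)⁻¹ :=
    map_inv (Matrix.GeneralLinearGroup.map (algebraMap F (AlgebraicClosure F))) φ
  rw [hinv] at ha hb hc hd
  have hne {x y u v : AlgebraicClosure F}
      (hu : (glMap (AlgebraicClosure F) φ)⁻¹ • (x : OnePoint (AlgebraicClosure F)) = u)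
      (hv : (glMap (AlgebraicClosure F) φ)⁻¹ • (y : OnePoint (AlgebraicClosure F)) = v)
      (hxy : x ≠ y) : u ≠ v := by
    rintro rfl
    rw [← hv] at hu
    exact hxy (OnePoint.coe_injective (MulAction.injective _ hu))
  refine ⟨y₁, y₂, hf'.symm, hh.symm, hne hb ha h3, hne hd hc h4, hne hc ha h5, hne hc hb h6,
    fun a => ?_⟩
  rw [baseChange_moebius, baseChange_substGL, mem_ramSet_moebius_substGL hf, h7, ← ha, ← hb, ← hc,
    ← hd]
  simp only [eq_inv_smul_iff]

theorem ClassIIIb.exists_ramPts {f : RatFunc F} (hf : ClassIIIb f) :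
    ∃ ρ₁ ρ₂, RamPts f ρ₁ ρ₂ := by
  obtain ⟨s, t, ht, hst, he, P, Q, hP, hQ, hP2, hQ2, hPi, hQi, hPQ, hG⟩ := hf.2
  obtain ⟨ρ₁, ρ₂, h, -⟩ := exists_ramPts_fst ht hst hP hQ hP2 hQ2 hPi hQi hPQ hG
  refine h.of_equivalent (he.symm hf.nonconst) ?_
  rw [baseChange_fst]
  exact fst_nonconst _ _

end Lambda

/-! ### Existence of `θ` and normal forms -/

section Theta

variable {K : Type*} [Field K]

theorem IsTheta.of_equivalent {f g : RatFunc K} {c : K} (h : Equivalent f g) (hf : Nonconst f)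
    (hg : IsTheta g c) : IsTheta f c := by
  rcases hg with ⟨hc, hg⟩ | ⟨t, ht, hc, hg⟩
  · exact Or.inl ⟨hc, h.trans hg hf⟩
  · exact Or.inr ⟨t, ht, hc, h.trans hg hf⟩

/-- The two kinds of normal form are separated by `1/t ≠ 0`, and `1/t` determines `t`. -/
theorem IsTheta.equivalent {f g : RatFunc K} {c : K} (hf : IsTheta f c) (hg : IsTheta g c)
    (hg' : Nonconst g) (hf' : Nonconst f) : Equivalent f g := by
  rcases hf with ⟨hc, hf⟩ | ⟨t, ht, hc, hf⟩ <;> rcases hg with ⟨hd, hg⟩ | ⟨u, hu, hd, hg⟩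
  · exact hf.trans (hg.symm hg') hf'
  · exact absurd (hd.symm.trans hc) (one_div_ne_zero hu)
  · exact absurd (hc.symm.trans hd) (one_div_ne_zero ht)
  · obtain rfl : t = u := by
      rw [hc, one_div, one_div] at hd
      exact inv_injective hd
    exact hf.trans (hg.symm hg') hf'

/-- After subtraction of the constant `c`, scaling `X` by `k` and the values by `w` leaves two
coefficients to normalise to `1`: those of `X³` and `1` if `b = 0`, which asks for a cube root of
`d/a`, and those of `X³` and `X²` otherwise. -/
theorem exists_isTheta_div_X [IsAlgClosed K] {a b c d : K} (ha : a ≠ 0) (hd : d ≠ 0) :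
    ∃ e, IsTheta ((RatFunc.C a * RatFunc.X ^ 3 + RatFunc.C b * RatFunc.X ^ 2 +
      RatFunc.C c * RatFunc.X + RatFunc.C d) / RatFunc.X) e := by
  have C0 {x : K} (hx : x ≠ 0) : RatFunc.C x ≠ 0 := by simpa using hx
  have hX : (RatFunc.X : RatFunc K) ≠ 0 := RatFunc.X_ne_zero
  have key (k w : K) (hk : k ≠ 0) (hw : w ≠ 0) :
      Equivalent ((RatFunc.C a * RatFunc.X ^ 3 + RatFunc.C b * RatFunc.X ^ 2 +
        RatFunc.C c * RatFunc.X + RatFunc.C d) / RatFunc.X)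
        ((RatFunc.C (w * a * k ^ 2) * RatFunc.X ^ 3 + RatFunc.C (w * b * k) * RatFunc.X ^ 2 +
          RatFunc.C (w * d / k)) / RatFunc.X) := by
    refine equivalent_iff.mpr
      ⟨mkGL w (-(w * c)) 0 1 (by simpa using hw), mkGL k 0 0 1 (by simpa using hk), ?_⟩
    have hs : substGL (mkGL k 0 0 1 (by simpa using hk)) RatFunc.X = RatFunc.C k * RatFunc.X := by
      rw [substGL_X, moebius_mkGL]
      simp
    have hk' := C0 hk
    simp only [moebius_mkGL, map_div₀, map_add, map_mul, map_pow, map_neg, map_zero, map_one, hs,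
      algHom_C]
    field_simp
    ring
  by_cases hb : b = 0
  · obtain ⟨k, hk⟩ := IsAlgClosed.exists_pow_nat_eq (d / a) (n := 3) (by norm_num)
    have hk0 : k ≠ 0 := by
      rintro rfl
      exact div_ne_zero hd ha (by rw [← hk]; simp)
    refine ⟨0, Or.inl ⟨rfl, ?_⟩⟩
    convert key k (k / d) hk0 (div_ne_zero hk0 hd) using 2
    have h1 : k / d * a * k ^ 2 = 1 := by
      rw [eq_div_iff ha] at hk
      field_simp
      linear_combination hk
    have h2 : k / d * d / k = 1 := by field_simp
    rw [h1, h2, hb]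
    simp
  · have hk0 : b / a ≠ 0 := div_ne_zero hb ha
    have hw : a / b ^ 2 ≠ 0 := div_ne_zero ha (pow_ne_zero _ hb)
    refine ⟨_, Or.inr ⟨a / b ^ 2 * d / (b / a), div_ne_zero (mul_ne_zero hw hd) hk0, rfl, ?_⟩⟩
    convert key (b / a) (a / b ^ 2) hk0 hw using 2
    have h1 : a / b ^ 2 * a * (b / a) ^ 2 = 1 := by field_simp
    have h2 : a / b ^ 2 * b * (b / a) = 1 := by field_simp
    rw [h1, h2]
    simp

open Polynomial in
theorem exists_isTheta_fst [IsAlgClosed K] {s t ρ : K} (ht : t ≠ 0) (hst : 1 + s + t ≠ 0)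
    (hρ : (gst s t).eval ρ = 0) (hρ' : (gst s t).derivative.eval ρ ≠ 0) :
    ∃ e, IsTheta (fst s t) e := by
  have hg : ρ ^ 4 - 2 * ρ ^ 3 - s * ρ ^ 2 - 2 * t * ρ + t = 0 := by
    simpa [gst] using hρ
  have hder : (gst s t).derivative.eval ρ =
      4 * ρ ^ 3 - 2 * (3 * ρ ^ 2) - s * (2 * ρ) - 2 * t := by
    simp [gst]
    ring
  have hρ0 : ρ ≠ 0 := by
    rintro rfl
    exact ht (by linear_combination hg)
  have hρ1 : ρ - 1 ≠ 0 := by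
    intro h
    rw [sub_eq_zero.mp h] at hg
    exact hst (by linear_combination -hg)
  -- The fibre through `ρ` is `2ρ + μ`: comparing coefficients in `X³ + sX + t - (μ + 2ρ)X(X - 1) =
  -- (X - ρ)²(X - μ)` gives both formulas.
  obtain ⟨μ, hs, rfl⟩ : ∃ μ, s = ρ ^ 2 + 2 * ρ * μ - (μ + 2 * ρ) ∧ t = -(ρ ^ 2 * μ) := by
    refine ⟨-t / ρ ^ 2, ?_, ?_⟩
    · field_simp
      linear_combination -hg
    · field_simp
  subst hs
  have hμ0 : μ ≠ 0 := by
    rintro rfl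
    simp at ht
  have hμ1 : μ - 1 ≠ 0 := by
    intro h
    rw [sub_eq_zero.mp h] at hst
    exact hst (by ring)
  -- A triple point would be a multiple root of `gst`.
  have hd : ρ - μ ≠ 0 := by
    intro h
    obtain rfl := sub_eq_zero.mp h
    refine hρ' ?_
    rw [hder]
    ring
  have C0 {x : K} (hx : x ≠ 0) : RatFunc.C x ≠ 0 := by simpa using hx
  obtain ⟨e, he⟩ := exists_isTheta_div_X (a := ρ * (ρ - 1) / (ρ - μ) ^ 3)
    (d := μ * (μ - 1) / (ρ - μ) ^ 3)
    (b := (ρ * (μ - 1) + μ * (ρ - 1) + ρ * (ρ - 1)) / (ρ - μ) ^ 3)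
    (c := (ρ * (μ - 1) + μ * (ρ - 1) + μ * (μ - 1)) / (ρ - μ) ^ 3)
    (div_ne_zero (mul_ne_zero hρ0 hρ1) (pow_ne_zero _ hd))
    (div_ne_zero (mul_ne_zero hμ0 hμ1) (pow_ne_zero _ hd))
  -- The substitution sends infinity to `ρ` and `0` to `μ`, and the outer map is `1/(y - (μ + 2ρ))`.
  -- The result has a double pole at infinity and a simple pole at `0`, hence is a cubic divided by
  -- `X`.
  refine ⟨e, he.of_equivalent (equivalent_iff.mpr
    ⟨mkGL 0 1 1 (-(μ + 2 * ρ)) (by simp), mkGL ρ μ 1 1 (by simpa using hd), ?_⟩)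
    (fst_nonconst _ _)⟩
  have hs : substGL (mkGL ρ μ 1 1 (by simpa using hd)) RatFunc.X =
      (RatFunc.C ρ * RatFunc.X + RatFunc.C μ) / (RatFunc.X + 1) := by
    rw [substGL_X, moebius_mkGL]
    simp
  have hX : (RatFunc.X : RatFunc K) ≠ 0 := RatFunc.X_ne_zero
  have h1 : (RatFunc.X : RatFunc K) + 1 ≠ 0 := by
    simpa using nonconst_X.linear_ne_zero (K := K) (c := 1) (d := 1) (by simp)
  have h2 : RatFunc.C ρ * RatFunc.X + RatFunc.C μ ≠ 0 := nonconst_X.linear_ne_zero (Or.inl hρ0)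
  have h3 : (RatFunc.C ρ - 1) * RatFunc.X + (RatFunc.C μ - 1) ≠ 0 := by
    simpa using nonconst_X.linear_ne_zero (K := K) (c := ρ - 1) (d := μ - 1) (Or.inl hρ1)
  have hd' : RatFunc.C ρ - RatFunc.C μ ≠ 0 := by
    rw [← map_sub]
    exact C0 hd
  simp only [moebius_mkGL, fst, map_div₀, map_add, map_mul, map_pow, map_neg, map_zero, map_one,
    map_sub, hs, algHom_C, map_ofNat]
  generalize RatFunc.C ρ = r at *
  generalize RatFunc.C μ = m at *
  generalize (RatFunc.X : RatFunc K) = x at *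
  have e1 : (r * x + m) / (x + 1) - 1 = ((r - 1) * x + (m - 1)) / (x + 1) := by
    field_simp
    ring
  have e2 : (((r * x + m) / (x + 1)) ^ 3 + (r ^ 2 + 2 * r * m - (m + 2 * r)) *
      ((r * x + m) / (x + 1)) + -(r ^ 2 * m)) /
      ((r * x + m) / (x + 1) * (((r - 1) * x + (m - 1)) / (x + 1))) =
      (m + 2 * r) + (r - m) ^ 3 * x /
        ((x + 1) * (r * x + m) * ((r - 1) * x + (m - 1))) := by
    obtain ⟨z, hz⟩ : ∃ z, z = (r - 1) * x + (m - 1) := ⟨_, rfl⟩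
    rw [← hz] at h3 ⊢
    field_simp
    rw [hz]
    ring
  rw [e1, e2]
  field_simp
  ring

end Theta

/-! ### Descent of degree one functions -/

section Descent

variable {F : Type*} [Field F] {K : Type*} [Field K] [Algebra F K]

open Polynomial in
/-- A linear relation over an extension between polynomials over `F` may be pushed forward along
an `F`-linear functional. -/
theorem linear_relation_descent (ℓ : K →ₗ[F] F) {a b c d : K} {p₁ p₂ p₃ p₄ : F[X]}
    (h : C c * p₁.map (algebraMap F K) + C d * p₂.map (algebraMap F K) =
      C a * p₃.map (algebraMap F K) + C b * p₄.map (algebraMap F K)) :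
    C (ℓ c) * p₁ + C (ℓ d) * p₂ = C (ℓ a) * p₃ + C (ℓ b) * p₄ := by
  ext n
  have h1 := congrArg ℓ (congrArg (coeff · n) h)
  simp only [coeff_add, coeff_C_mul, coeff_map, map_add] at h1 ⊢
  have key (x : K) (y : F) : ℓ (x * algebraMap F K y) = ℓ x * y := by
    rw [mul_comm, ← Algebra.smul_def, map_smul, smul_eq_mul, mul_comm]
  simpa only [key] using h1

-- Cleared of denominators, `g = ψ ∘ f` is a linear relation among polynomials over `F` whose
-- coefficients are the entries of `ψ`. A functional not killing the whole bottom row of `ψ` yields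
-- a relation over `F` that can be solved for `g`.
open Polynomial in
theorem exists_moebius_of_baseChange {f g : RatFunc F} (hf : Nonconst f) (hg : Nonconst g)
    (hfK : Nonconst (baseChange K f)) {ψ : GL (Fin 2) K}
    (h : baseChange K g = moebius ψ (baseChange K f)) : ∃ ψ₀ : GL (Fin 2) F, g = moebius ψ₀ f := by
  have hden := hfK.gl_denom_ne_zero ψ
  obtain ⟨ℓ, hℓ⟩ : ∃ ℓ : K →ₗ[F] F, ℓ (ψ 1 0) ≠ 0 ∨ ℓ (ψ 1 1) ≠ 0 := by
    by_contra! h0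
    have h1 := (Module.forall_dual_apply_eq_zero_iff F (ψ 1 0)).mp fun ℓ => (h0 ℓ).1
    have h2 := (Module.forall_dual_apply_eq_zero_iff F (ψ 1 1)).mp fun ℓ => (h0 ℓ).2
    exact gl_det_ne_zero ψ (by rw [h1, h2]; ring)
  have hr : algebraMap F[X] (RatFunc F) f.denom ≠ 0 := RatFunc.algebraMap_ne_zero f.denom_ne_zero
  have hv : algebraMap F[X] (RatFunc F) g.denom ≠ 0 := RatFunc.algebraMap_ne_zero g.denom_ne_zero
  have hp := (div_eq_iff hr).mp (RatFunc.num_div_denom f)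
  have hu := (div_eq_iff hv).mp (RatFunc.num_div_denom g)
  have hp' := congrArg (baseChange K) hp
  have hu' := congrArg (baseChange K) hu
  rw [map_mul, baseChange_algebraMap, baseChange_algebraMap] at hp' hu'
  rw [moebius, eq_div_iff hden] at h
  have hrel : C (ψ 1 0) * (f.num * g.num).map (algebraMap F K) +
      C (ψ 1 1) * (f.denom * g.num).map (algebraMap F K) =
      C (ψ 0 0) * (f.num * g.denom).map (algebraMap F K) +
      C (ψ 0 1) * (f.denom * g.denom).map (algebraMap F K) := by
    apply RatFunc.algebraMap_injective K
    simp only [Polynomial.map_mul, map_mul, map_add, RatFunc.algebraMap_C, hp', hu']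
    linear_combination algebraMap K[X] (RatFunc K) (f.denom.map (algebraMap F K)) *
      algebraMap K[X] (RatFunc K) (g.denom.map (algebraMap F K)) * h
  have hF := congrArg (algebraMap F[X] (RatFunc F)) (linear_relation_descent ℓ hrel)
  simp only [map_mul, map_add, RatFunc.algebraMap_C, hp, hu] at hF
  have hF' : g * (RatFunc.C (ℓ (ψ 1 0)) * f + RatFunc.C (ℓ (ψ 1 1))) =
      RatFunc.C (ℓ (ψ 0 0)) * f + RatFunc.C (ℓ (ψ 0 1)) := by
    apply mul_left_cancel₀ (mul_ne_zero hr hv)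
    linear_combination hF
  have hd0 := hf.linear_ne_zero hℓ
  rw [← eq_div_iff hd0] at hF'
  refine ⟨mkGL (ℓ (ψ 0 0)) (ℓ (ψ 0 1)) (ℓ (ψ 1 0)) (ℓ (ψ 1 1)) fun hdet => ?_, ?_⟩
  -- A vanishing determinant would make `g` constant.
  · by_cases hc : ℓ (ψ 1 0) = 0
    · have hd := hℓ.resolve_left (not_not.mpr hc)
      have ha : ℓ (ψ 0 0) = 0 := by simpa [hc, hd] using hdet
      exact hg ⟨ℓ (ψ 0 1) / ℓ (ψ 1 1), by rw [hF', ha, hc, map_div₀]; simp⟩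
    · refine hg ⟨ℓ (ψ 0 0) / ℓ (ψ 1 0), ?_⟩
      have hc' : RatFunc.C (ℓ (ψ 1 0)) ≠ 0 := by simpa using hc
      rw [hF', map_div₀, div_eq_div_iff hd0 hc']
      have := congrArg RatFunc.C hdet
      simp only [map_sub, map_mul, map_zero] at this
      linear_combination -this
  · rw [moebius_mkGL, hF']

theorem moebius_eq_of_proportional {A B : GL (Fin 2) K} {k : K} (hk : k ≠ 0)
    (h : ∀ i j, A i j = k * B i j) (f : RatFunc K) : moebius A f = moebius B f := by
  have hk' : RatFunc.C k ≠ 0 := by simpa using hk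
  simp only [moebius, h, map_mul, mul_assoc, ← mul_add]
  rw [mul_div_mul_left _ _ hk']

theorem substGL_eq_of_proportional {A B : GL (Fin 2) K} {k : K} (hk : k ≠ 0)
    (h : ∀ i j, A i j = k * B i j) : substGL A = substGL B :=
  algHom_eq_of_X (by rw [substGL_X, substGL_X, moebius_eq_of_proportional hk h])

/-- Two degree one functions which agree at three points are proportional. -/
theorem proportional_of_three_points {a b c d a' b' c' d' x₁ x₂ x₃ y₁ y₂ y₃ : K}
    (hD : a * d - b * c ≠ 0) (h12 : x₁ ≠ x₂) (h13 : x₁ ≠ x₃) (h23 : x₂ ≠ x₃)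
    (h1 : a * x₁ + b = y₁ * (c * x₁ + d)) (h1' : a' * x₁ + b' = y₁ * (c' * x₁ + d'))
    (h2 : a * x₂ + b = y₂ * (c * x₂ + d)) (h2' : a' * x₂ + b' = y₂ * (c' * x₂ + d'))
    (h3 : a * x₃ + b = y₃ * (c * x₃ + d)) (h3' : a' * x₃ + b' = y₃ * (c' * x₃ + d')) :
    ∃ e, a' = e * a ∧ b' = e * b ∧ c' = e * c ∧ d' = e * d := by
  -- Agreement at `x` is a quadratic equation in `x`; three distinct roots force all its
  -- coefficients to vanish.
  have quad {x y : K} (h : a * x + b = y * (c * x + d)) (h' : a' * x + b' = y * (c' * x + d')) :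
      (a * c' - a' * c) * x ^ 2 + (a * d' + b * c' - a' * d - b' * c) * x +
        (b * d' - b' * d) = 0 := by
    linear_combination (c' * x + d') * h - (c * x + d) * h'
  have q1 := quad h1 h1'
  have q2 := quad h2 h2'
  have q3 := quad h3 h3'
  generalize hu : a * c' - a' * c = u at *
  generalize hv : a * d' + b * c' - a' * d - b' * c = v at *
  generalize hw : b * d' - b' * d = w at *
  have l12 : u * (x₁ + x₂) + v = 0 := by
    apply mul_left_cancel₀ (sub_ne_zero.mpr h12)
    linear_combination q1 - q2
  have l13 : u * (x₁ + x₃) + v = 0 := by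
    apply mul_left_cancel₀ (sub_ne_zero.mpr h13)
    linear_combination q1 - q3
  have hu0 : u = 0 := by
    apply mul_left_cancel₀ (sub_ne_zero.mpr h23)
    linear_combination l12 - l13
  have hv0 : v = 0 := by linear_combination l12 - (x₁ + x₂) * hu0
  have hw0 : w = 0 := by linear_combination q1 - x₁ ^ 2 * hu0 - x₁ * hv0
  rw [hu0] at hu
  rw [hv0] at hv
  rw [hw0] at hw
  -- For the two coefficient matrices `M` and `M'`, this is the upper left entry of `M⁻¹M'`, which
  -- is a scalar matrix.
  refine ⟨(d * a' - b * c') / (a * d - b * c), ?_, ?_, ?_, ?_⟩ <;>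
    rw [div_mul_eq_mul_div, eq_div_iff hD]
  · linear_combination b * hu
  · linear_combination -a * hw + b * hv
  · linear_combination d * hu
  · linear_combination d * hv - c * hw

end Descent

/-! ### Invariance and symmetries of the cross ratio -/

section CrossRatio

variable {K : Type*} [Field K]

open Classical in
theorem crossRatio_smul (φ : GL (Fin 2) K) {x₁ x₂ x₃ x₄ y₁ y₂ y₃ y₄ : K}
    (h1 : φ • (x₁ : OnePoint K) = y₁) (h2 : φ • (x₂ : OnePoint K) = y₂)
    (h3 : φ • (x₃ : OnePoint K) = y₃) (h4 : φ • (x₄ : OnePoint K) = y₄)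
    (h14 : x₁ ≠ x₄) (h23 : x₂ ≠ x₃) :
    crossRatio y₁ y₂ y₃ y₄ = crossRatio x₁ x₂ x₃ x₄ := by
  rw [smul_coe_eq_coe_iff] at h1 h2 h3 h4
  obtain ⟨d1, h1⟩ := h1
  obtain ⟨d2, h2⟩ := h2
  obtain ⟨d3, h3⟩ := h3
  obtain ⟨d4, h4⟩ := h4
  have hD := gl_det_ne_zero φ
  have key {x x' y y' : K} (h : φ 0 0 * x + φ 0 1 = y * (φ 1 0 * x + φ 1 1))
      (h' : φ 0 0 * x' + φ 0 1 = y' * (φ 1 0 * x' + φ 1 1)) (d : φ 1 0 * x + φ 1 1 ≠ 0)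
      (d' : φ 1 0 * x' + φ 1 1 ≠ 0) : y - y' = (φ 0 0 * φ 1 1 - φ 0 1 * φ 1 0) * (x - x') /
        ((φ 1 0 * x + φ 1 1) * (φ 1 0 * x' + φ 1 1)) := by
    rw [eq_div_iff (mul_ne_zero d d')]
    linear_combination (φ 1 0 * x + φ 1 1) * h' - (φ 1 0 * x' + φ 1 1) * h
  have h14' := sub_ne_zero.mpr h14
  have h23' := sub_ne_zero.mpr h23
  rw [crossRatio, crossRatio, key h1 h3 d1 d3, key h2 h4 d2 d4, key h1 h4 d1 d4, key h2 h3 d2 d3]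
  generalize φ 1 0 * x₁ + φ 1 1 = e1 at *
  generalize φ 1 0 * x₂ + φ 1 1 = e2 at *
  generalize φ 1 0 * x₃ + φ 1 1 = e3 at *
  generalize φ 1 0 * x₄ + φ 1 1 = e4 at *
  generalize φ 0 0 * φ 1 1 - φ 0 1 * φ 1 0 = D at *
  field_simp

theorem crossRatio_swap_middle {x₁ x₂ x₃ x₄ : K} (h14 : x₁ ≠ x₄) (h23 : x₂ ≠ x₃) :
    crossRatio x₁ x₃ x₂ x₄ = 1 - crossRatio x₁ x₂ x₃ x₄ := by
  have h14' := sub_ne_zero.mpr h14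
  have h23' := sub_ne_zero.mpr h23
  have h32' := sub_ne_zero.mpr h23.symm
  rw [crossRatio, crossRatio, eq_sub_iff_add_eq, div_add_div _ _ (mul_ne_zero h14' h32')
    (mul_ne_zero h14' h23'), div_eq_one_iff_eq (mul_ne_zero (mul_ne_zero h14' h32')
    (mul_ne_zero h14' h23'))]
  ring

theorem crossRatio_ne_zero {x₁ x₂ x₃ x₄ : K} (h13 : x₁ ≠ x₃) (h24 : x₂ ≠ x₄)
    (h14 : x₁ ≠ x₄) (h23 : x₂ ≠ x₃) : crossRatio x₁ x₂ x₃ x₄ ≠ 0 :=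
  div_ne_zero (mul_ne_zero (sub_ne_zero.mpr h13) (sub_ne_zero.mpr h24))
    (mul_ne_zero (sub_ne_zero.mpr h14) (sub_ne_zero.mpr h23))

/-- The equation factors as `(2C - 1)(C(1 - C) - 1) = 0`. The first factor gives `5/2` (and forces
`2 ≠ 0`), the second gives `1`. -/
theorem add_inv_eq_one_or_five_halves {C : K} (h0 : C ≠ 0) (h1 : 1 - C ≠ 0)
    (h : C + C⁻¹ = (1 - C) + (1 - C)⁻¹) : C + C⁻¹ = 1 ∨ C + C⁻¹ = 5 / 2 := by
  have h2 : (2 * C - 1) * (C * (1 - C) - 1) = 0 := by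
    field_simp at h
    linear_combination h
  rcases mul_eq_zero.mp h2 with h3 | h3
  · right
    have h20 : (2 : K) ≠ 0 := by
      intro h20
      rw [h20] at h3
      simp at h3
    field_simp
    linear_combination (C - 2) * h3
  · left
    field_simp
    linear_combination -h3

end CrossRatio

/-! ### Descent of the equivalence from the closure to `F` -/

section Main

variable {F : Type*} [Field F]

theorem RamPts.exists_partner {f : RatFunc F} {ρ₁ ρ₂ y : AlgebraicClosure F}
    (h : RamPts f ρ₁ ρ₂)
    (hy : (y : OnePoint (AlgebraicClosure F)) ∈ ramSet (baseChange (AlgebraicClosure F) f)) :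
    ∃ z, RamPts f y z := by
  rw [h.2.2.2.2.2.2] at hy
  simp only [OnePoint.coe_eq_coe] at hy
  rcases hy with rfl | rfl | rfl | rfl
  exacts [⟨_, h⟩, ⟨_, h.frob_left⟩, ⟨_, h.swap⟩, ⟨_, h.swap.frob_left⟩]

theorem RamPts.eq_of_mem {f : RatFunc F} {ρ₁ ρ₂ y : AlgebraicClosure F} (h : RamPts f ρ₁ ρ₂)
    (hy : (y : OnePoint (AlgebraicClosure F)) ∈ ramSet (baseChange (AlgebraicClosure F) f)) :
    y = ρ₁ ∨ y = ρ₁ ^ Nat.card F ∨ y = ρ₂ ∨ y = ρ₂ ^ Nat.card F := by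
  rw [h.2.2.2.2.2.2] at hy
  simpa only [OnePoint.coe_eq_coe] using hy

theorem RamPts.frob_ne {f : RatFunc F} {ρ₁ ρ₂ : AlgebraicClosure F} (h : RamPts f ρ₁ ρ₂) :
    ρ₂ ^ Nat.card F ≠ ρ₁ ∧ ρ₂ ^ Nat.card F ≠ ρ₁ ^ Nat.card F := by
  obtain ⟨-, -, -, -, h5, h6, -⟩ := h.swap.frob_left.swap
  exact ⟨h5, h6⟩

/-- If four ramification points with `λ ∉ {1, 5/2}` are moved to each other preserving `λ`, then
conjugate pairs go to conjugate pairs. -/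
theorem RamPts.conjugate_of_crossRatio {f : RatFunc F} {ρ₁ ρ₂ y₁ y₂ y₃ y₄ : AlgebraicClosure F}
    (h : RamPts f ρ₁ ρ₂) (hL1 : lambda f ≠ 1) (hL2 : lambda f ≠ 5 / 2)
    (m1 : (y₁ : OnePoint (AlgebraicClosure F)) ∈ ramSet (baseChange (AlgebraicClosure F) f))
    (m2 : (y₂ : OnePoint (AlgebraicClosure F)) ∈ ramSet (baseChange (AlgebraicClosure F) f))
    (m3 : (y₃ : OnePoint (AlgebraicClosure F)) ∈ ramSet (baseChange (AlgebraicClosure F) f))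
    (m4 : (y₄ : OnePoint (AlgebraicClosure F)) ∈ ramSet (baseChange (AlgebraicClosure F) f))
    (h12 : y₁ ≠ y₂) (h13 : y₁ ≠ y₃) (h14 : y₁ ≠ y₄) (h23 : y₂ ≠ y₃) (h24 : y₂ ≠ y₄)
    (h34 : y₃ ≠ y₄)
    (hcr : lambda f = crossRatio y₁ y₂ y₃ y₄ + (crossRatio y₁ y₂ y₃ y₄)⁻¹) :
    y₂ = y₁ ^ Nat.card F ∧ y₄ = y₃ ^ Nat.card F := by
  obtain ⟨z, hz⟩ := h.exists_partner m1
  rcases hz.eq_of_mem m2 with e2 | e2 | e2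
  · exact absurd e2.symm h12
  · refine ⟨e2, ?_⟩
    obtain ⟨w, hw⟩ := h.exists_partner m3
    have hw' : RamPts f y₃ y₁ := by
      rcases hw.eq_of_mem m1 with e | e | e | e
      · exact absurd e h13
      · exfalso
        apply h23
        rw [e2, e, hw.1]
      · rw [e]; exact hw
      · rw [e]; exact hw.swap.frob_left.swap
    rcases hw'.eq_of_mem m4 with e | e | e | e
    · exact absurd e.symm h34
    · exact e
    · exact absurd e.symm h14
    · exact absurd (e2.trans e.symm) h24
  -- Here `y₁` and `y₂` lie in different conjugate pairs, so `y₃` and `y₄` are their conjugates in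
  -- some order. The cross ratio of the `yᵢ` is then `1 - C` or its inverse.
  · exfalso
    have hw : RamPts f y₁ y₂ := by
      rcases e2 with e | e
      · rw [e]; exact hz
      · rw [e]; exact hz.swap.frob_left.swap
    have hlam := hw.lambda_eq
    obtain ⟨a1, a2⟩ := hw.frob_ne
    obtain ⟨b1, b2, b3, b4, b5, b6, -⟩ := hw
    have c1 : crossRatio y₁ y₂ (y₁ ^ Nat.card F) (y₂ ^ Nat.card F) =
        1 - crossRatio y₁ (y₁ ^ Nat.card F) y₂ (y₂ ^ Nat.card F) :=
      crossRatio_swap_middle a1.symm b6.symm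
    have c0 : crossRatio y₁ (y₁ ^ Nat.card F) y₂ (y₂ ^ Nat.card F) ≠ 0 :=
      crossRatio_ne_zero b5.symm a2.symm a1.symm b6.symm
    have c2 : crossRatio y₁ y₂ (y₁ ^ Nat.card F) (y₂ ^ Nat.card F) ≠ 0 :=
      crossRatio_ne_zero b3.symm b4.symm a1.symm b6
    have hcr' : lambda f = crossRatio y₁ y₂ (y₁ ^ Nat.card F) (y₂ ^ Nat.card F) +
        (crossRatio y₁ y₂ (y₁ ^ Nat.card F) (y₂ ^ Nat.card F))⁻¹ := by
      have hw : RamPts f y₁ y₂ := by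
        rcases e2 with e | e
        · rw [e]; exact hz
        · rw [e]; exact hz.swap.frob_left.swap
      rcases hw.eq_of_mem m3 with e | e | e | e
      · exact absurd e.symm h13
      · rcases hw.eq_of_mem m4 with e' | e' | e' | e'
        · exact absurd e'.symm h14
        · exact absurd (e.trans e'.symm) h34
        · exact absurd e'.symm h24
        · rwa [e, e'] at hcr
      · exact absurd e.symm h23
      · rcases hw.eq_of_mem m4 with e' | e' | e' | e'
        · exact absurd e'.symm h14
        · rw [e, e', crossRatio_swap', inv_inv, add_comm] at hcr
          exact hcr
        · exact absurd e'.symm h24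
        · exact absurd (e.trans e'.symm) h34
    rw [c1] at c2 hcr'
    rw [hlam] at hL1 hL2 hcr'
    rcases add_inv_eq_one_or_five_halves c0 c2 hcr' with h' | h'
    · exact hL1 h'
    · exact hL2 h'

open Classical in
/-- A degree one function over the algebraic closure commuting with Frobenius at three points of
the form `x, x^q, z` is proportional to one defined over `F`. -/
theorem exists_glMap_proportional [Finite F] {φ : GL (Fin 2) (AlgebraicClosure F)}
    {x z y w : AlgebraicClosure F} (hx : x ^ Nat.card F ≠ x)
    (hxx : (x ^ Nat.card F) ^ Nat.card F = x) (hzz : (z ^ Nat.card F) ^ Nat.card F = z)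
    (hyy : (y ^ Nat.card F) ^ Nat.card F = y) (hww : (w ^ Nat.card F) ^ Nat.card F = w)
    (hzx : z ≠ x) (hzx' : z ≠ x ^ Nat.card F)
    (h1 : φ • (x : OnePoint (AlgebraicClosure F)) = y)
    (h2 : φ • ((x ^ Nat.card F : AlgebraicClosure F) : OnePoint (AlgebraicClosure F)) =
      (y ^ Nat.card F : AlgebraicClosure F))
    (h3 : φ • (z : OnePoint (AlgebraicClosure F)) = w)
    (h4 : φ • ((z ^ Nat.card F : AlgebraicClosure F) : OnePoint (AlgebraicClosure F)) =
      (w ^ Nat.card F : AlgebraicClosure F)) :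
    ∃ (k : AlgebraicClosure F) (φ₀ : GL (Fin 2) F), k ≠ 0 ∧
      ∀ i j, φ i j = k * glMap (AlgebraicClosure F) φ₀ i j := by
  obtain ⟨σ, hσ⟩ := exists_frobenius (F := F)
  obtain ⟨-, h1⟩ := (smul_coe_eq_coe_iff _ _ _).mp h1
  obtain ⟨-, h2⟩ := (smul_coe_eq_coe_iff _ _ _).mp h2
  obtain ⟨-, h3⟩ := (smul_coe_eq_coe_iff _ _ _).mp h3
  obtain ⟨-, h4⟩ := (smul_coe_eq_coe_iff _ _ _).mp h4
  have hD := gl_det_ne_zero φ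
  obtain ⟨k, hk, hk'⟩ : ∃ k, k ≠ 0 ∧ ∃ i j, φ i j = k := by
    by_contra! h0
    have h00 (i j) : φ i j = 0 := by
      by_contra h
      exact h0 _ h i j rfl
    exact hD (by rw [h00, h00 0 1]; ring)
  obtain ⟨i₀, j₀, hij⟩ := hk'
  -- Scaling one entry to `1` fixes the representative: a scalar relating it to its Frobenius
  -- conjugate must then be `1`.
  obtain ⟨n, hn⟩ : ∃ n : Fin 2 → Fin 2 → AlgebraicClosure F, ∀ i j, φ i j = k * n i j :=
    ⟨fun i j => φ i j / k, fun i j => by field_simp⟩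
  have hn1 : n i₀ j₀ = 1 := by
    apply mul_left_cancel₀ hk
    rw [← hn, hij, mul_one]
  simp only [hn] at h1 h2 h3 h4 hD
  have hD' : n 0 0 * n 1 1 - n 0 1 * n 1 0 ≠ 0 := fun h => hD (by linear_combination k ^ 2 * h)
  have red {x y : AlgebraicClosure F} (h : k * n 0 0 * x + k * n 0 1 =
      y * (k * n 1 0 * x + k * n 1 1)) : n 0 0 * x + n 0 1 = y * (n 1 0 * x + n 1 1) := by
    apply mul_left_cancel₀ hk
    linear_combination h
  have frob {x y : AlgebraicClosure F} (h : n 0 0 * x + n 0 1 = y * (n 1 0 * x + n 1 1)) :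
      σ (n 0 0) * x ^ Nat.card F + σ (n 0 1) =
        y ^ Nat.card F * (σ (n 1 0) * x ^ Nat.card F + σ (n 1 1)) := by
    rw [← hσ, ← hσ]
    simp only [← map_mul, ← map_add, h]
  -- Conjugating the relation at `x^q` gives one at `x`, as `x` and `y` are fixed by the square of
  -- Frobenius. Thus `n` and its conjugate agree at `x`, `x^q` and `z`.
  have g1 := frob (red h2)
  have g2 := frob (red h1)
  have g3 := frob (red h4)
  rw [hxx, hyy] at g1
  rw [hzz, hww] at g3
  obtain ⟨e, e1, e2, e3, e4⟩ := proportional_of_three_points hD' hx.symm hzx.symm hzx'.symm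
    (red h1) g1 (red h2) g2 (red h3) g3
  have he : ∀ i j, σ (n i j) = e * n i j := by
    intro i j
    fin_cases i <;> fin_cases j <;> assumption
  have he1 : e = 1 := by
    have := he i₀ j₀
    rw [hn1, map_one, mul_one] at this
    exact this.symm
  have hF (i j) : ∃ c, algebraMap F (AlgebraicClosure F) c = n i j :=
    exists_algebraMap_of_pow_card (by rw [← hσ, he, he1, one_mul])
  choose m hm using hF
  have hdet : m 0 0 * m 1 1 - m 0 1 * m 1 0 ≠ 0 := by
    intro h
    apply hD'
    simp only [← hm, ← map_mul, ← map_sub, h, map_zero]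
  refine ⟨k, mkGL (m 0 0) (m 0 1) (m 1 0) (m 1 1) hdet, hk, fun i j => ?_⟩
  rw [hn, glMap_apply, ← hm]
  fin_cases i <;> fin_cases j <;> rfl

theorem ClassIIIb.exists_isTheta [Finite F] {f : RatFunc F} (hf : ClassIIIb f) :
    IsTheta (baseChange (AlgebraicClosure F) f) (theta f) := by
  obtain ⟨s, t, ht, hst, he, P, Q, hP, hQ, hP2, hQ2, hPi, hQi, hPQ, hG⟩ := hf.2
  obtain ⟨ρ₁, ρ₂, h, hg⟩ := exists_ramPts_fst ht hst hP hQ hP2 hQ2 hPi hQi hPQ hG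
  have ht' : algebraMap F (AlgebraicClosure F) t ≠ 0 := by simpa using ht
  have hst' : 1 + algebraMap F (AlgebraicClosure F) s +
      algebraMap F (AlgebraicClosure F) t ≠ 0 := by
    rw [← map_one (algebraMap F (AlgebraicClosure F)), ← map_add, ← map_add]
    exact (map_ne_zero _).mpr hst
  obtain ⟨a1, -⟩ := h.frob_ne
  -- The four roots of `gst` are distinct, so `ρ₁` is a simple root.
  obtain ⟨e, hθ⟩ := exists_isTheta_fst (ρ := ρ₁) ht' hst' (by rw [hg]; simp) (by
    rw [hg]
    simp [sub_eq_zero, h.2.2.1.symm, h.2.2.2.2.1.symm, a1.symm])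
  refine Classical.epsilon_spec (p := IsTheta (baseChange (AlgebraicClosure F) f)) ⟨e, ?_⟩
  refine IsTheta.of_equivalent (he.baseChange _) hf.nonconst_baseChange ?_
  rwa [baseChange_fst]

theorem equivalent_of_theta_eq_of_lambda_eq [Finite F] {f g : RatFunc F} (hf : ClassIIIb f)
    (hg : ClassIIIb g) (hθ : theta f = theta g) (hL : lambda f = lambda g)
    (hL1 : lambda f ≠ 1) (hL2 : lambda f ≠ 5 / 2) : Equivalent f g := by
  classical
  have hfK := hf.nonconst_baseChange
  have hgK := hg.nonconst_baseChange
  obtain ⟨ψ, φ, h⟩ := equivalent_iff.mp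
    (hf.exists_isTheta.equivalent (hθ ▸ hg.exists_isTheta) hgK hfK)
  obtain ⟨τ₁, τ₂, hτ⟩ := hf.exists_ramPts
  obtain ⟨ρ₁, ρ₂, hρ⟩ := hg.exists_ramPts
  -- All ramification points of `f` are finite, so `φ` has no pole at a ramification point of `g`.
  have himg (x : AlgebraicClosure F)
      (hx : (x : OnePoint (AlgebraicClosure F)) ∈ ramSet (baseChange (AlgebraicClosure F) g)) :
      ∃ y : AlgebraicClosure F, φ • (x : OnePoint (AlgebraicClosure F)) = y ∧
        (y : OnePoint (AlgebraicClosure F)) ∈ ramSet (baseChange (AlgebraicClosure F) f) := by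
    rw [h, mem_ramSet_moebius_substGL hfK] at hx
    rcases (hτ.2.2.2.2.2.2 _).mp hx with e | e | e | e <;>
      exact ⟨_, e, e ▸ hx⟩
  have hmem := hρ.2.2.2.2.2.2
  obtain ⟨y₁, e1, m1⟩ := himg ρ₁ ((hmem _).mpr (by simp))
  obtain ⟨y₂, e2, m2⟩ := himg (ρ₁ ^ Nat.card F) ((hmem _).mpr (by simp))
  obtain ⟨y₃, e3, m3⟩ := himg ρ₂ ((hmem _).mpr (by simp))
  obtain ⟨y₄, e4, m4⟩ := himg (ρ₂ ^ Nat.card F) ((hmem _).mpr (by simp))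
  have hne {x x' y y' : AlgebraicClosure F} (hy : φ • (x : OnePoint (AlgebraicClosure F)) = y)
      (hy' : φ • (x' : OnePoint (AlgebraicClosure F)) = y') (hxx : x ≠ x') : y ≠ y' := by
    rintro rfl
    exact hxx (OnePoint.coe_injective (MulAction.injective φ (hy.trans hy'.symm)))
  obtain ⟨a1, a2⟩ := hρ.frob_ne
  have hlam := hρ.lambda_eq
  obtain ⟨b1, b2, b3, b4, b5, b6, -⟩ := hρ
  rw [← hL, ← crossRatio_smul φ e1 e2 e3 e4 a1.symm b6.symm] at hlam
  obtain ⟨rfl, rfl⟩ := hτ.conjugate_of_crossRatio hL1 hL2 m1 m2 m3 m4 (hne e1 e2 b3.symm)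
    (hne e1 e3 b5.symm) (hne e1 e4 a1.symm) (hne e2 e3 b6.symm) (hne e2 e4 a2.symm)
    (hne e3 e4 b4.symm) hlam
  obtain ⟨_, hy1⟩ := hτ.exists_partner m1
  obtain ⟨_, hy3⟩ := hτ.exists_partner m3
  obtain ⟨k, φ₀, hk, hφ⟩ := exists_glMap_proportional b3 b1 b2 hy1.1 hy3.1 b5 b6 e1 e2 e3 e4
  -- Scalars do not affect substitution, so `φ` may be replaced by `φ₀`, and only `ψ` remains to be
  -- descended.
  rw [substGL_eq_of_proportional hk hφ, ← baseChange_substGL] at h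
  obtain ⟨ψ₀, hψ⟩ := exists_moebius_of_baseChange (hf.nonconst.algHom (substGL φ₀)) hg.nonconst
    (by rw [baseChange_substGL]; exact hfK.algHom _) h
  exact equivalent_iff.mpr ⟨ψ₀, φ₀, hψ⟩

end Main

end CubicRat

end

theorem theoremT6p3 {F : Type*} [Field F] [Finite F] (f g : RatFunc F)
    (hf : CubicRat.ClassIIIb f) (hg : CubicRat.ClassIIIb g)
    (hθ : CubicRat.theta f = CubicRat.theta g)
    (hL : CubicRat.lambda f = CubicRat.lambda g)
    (hL1 : CubicRat.lambda f ≠ 1) (hL2 : CubicRat.lambda f ≠ 5 / 2) :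
    CubicRat.Equivalent f g :=
  CubicRat.equivalent_of_theta_eq_of_lambda_eq hf hg hθ hL hL1 hL2
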